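/- **Setting.** There are $I$ users and $J$ providers, with $I<J$. Provider $j$ has supply $Q_j>0$. User $i$ has a utility function $u_i$ on $[0,\infty)$ that is continuous, differentiable on $(0,\infty)$, increasing and strictly concave. The channel quality offsets $c_{ij}$ are independent, almost surely positive real random variables whose laws have no atoms (the laws may differ). For a demand vector $q=(q_{ij})$ put $x_i(q)=\sum_{j}q_{ij}c_{ij}$. The social welfare problem is to maximize $\sum_i u_i(x_i(q))$ over $q\ge 0$ with $\sum_i q_{ij}=Q_j$ for all $j$. An *equilibrium* is a pair $(q^*,p^*)$ such that $q^*$ solves this problem and $p^*\in\mathbb{R}^J$ is a vector of Lagrange multipliers for the constraints $\sum_i q_{ij}=Q_j$, i.e. $q^*$ maximizes $\sum_i u_i(x_i(q))+\sum_j p^*_j\bigl(Q_j-\sum_i q_{ij}\bigr)$ over all $q\ge 0$. For $x,y\in\mathbb{R}$ let $(x)^+_y=x$ if $y>0$ and $(x)^+_y=\max(0,x)$ if $y\le 0$. Given update rates $k^q_{ij},k^p_j>0$, the primal–dual dynamics are $$\dot q_{ij}=k^q_{ij}\,\bigl(f_{ij}-p_j\bigr)^+_{q_{ij}},\qquad \dot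 p_j=k^p_j\Bigl(\sum_{i}q_{ij}-Q_j\Bigr)^+_{p_j},\qquad f_{ij}=c_{ij}\,u_i'(x_i(q)),$$ where $u_i'(0)$ means the one-sided derivative. A solution trajectory is a pair $(q(t),p(t))$, $t\ge 0$, of locally absolutely continuous functions with $q(0)\ge 0$ and $p(0)\ge 0$ for which the derivatives $u_i'(x_i(q(t)))$ exist and the equations hold at almost every $t\ge 0$. **Theorem.** With probability one (over the draw of the $c_{ij}$) the following holds. Let $(q^*,p^*)$ be an equilibrium at which every user is undecided, i.e. $|\{j: q^*_{ij}>0\}|>1$ for every $i$. Then $(q^*,p^*)$ is the only equilibrium. Moreover, if all demand update rates are equal, $k^q_{ij}=k>0$ for all $i,j$, and the price update rates $k^p_j>0$ are not integer multiples of each other, i.e. $k^p_j\neq a\,k^p_{j'}$ for all $j\ne j'$ and all positive integers $a$, then every solution trajectory satisfies $(q(t),p(t))\to(q^*,p^*)$ as $t\to\infty$. -/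

import Mathlib

open MeasureTheory ProbabilityTheory Filter Topology Set

noncomputable section

namespace ProviderCompetition

variable {I J : ℕ}

/-- A utility function on the nonnegative half-line: continuous on `[0, ∞)`, differentiable on
`(0, ∞)`, increasing and strictly concave. (A finite marginal utility at `0` is allowed but not
required, so `log (1 + x)` and `x ^ (1 - α) / (1 - α)` with `0 < α < 1` both qualify.) -/
structure IsUtility (v : ℝ → ℝ) : Prop where
  continuousOn : ContinuousOn v (Ici 0)
  differentiableOn : DifferentiableOn ℝ v (Ioi 0)
  strictMonoOn : StrictMonoOn v (Ici 0)
  strictConcaveOn : StrictConcaveOn ℝ (Ici 0) v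

/-- Effective resource `x_i = ∑_j q_ij c_ij` of user `i`. -/
def effRes (c q : Fin I → Fin J → ℝ) (i : Fin I) : ℝ := ∑ j, q i j * c i j

/-- Social welfare `∑_i u_i (x_i)` as a function of the demand vector. -/
def welfare (u : Fin I → ℝ → ℝ) (c q : Fin I → Fin J → ℝ) : ℝ := ∑ i, u i (effRes c q i)

/-- Demand vectors with nonnegative entries. -/
def nonnegDemand (I J : ℕ) : Set (Fin I → Fin J → ℝ) := {q | ∀ i j, 0 ≤ q i j}

/-- Feasible demand vectors of the social welfare problem: nonnegative, and the demand for each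
provider equals its supply. -/
def feasible (I : ℕ) {J : ℕ} (Q : Fin J → ℝ) : Set (Fin I → Fin J → ℝ) :=
  {q | q ∈ nonnegDemand I J ∧ ∀ j, ∑ i, q i j = Q j}

/-- Lagrangian of the social welfare problem. -/
def lagrangian (u : Fin I → ℝ → ℝ) (Q : Fin J → ℝ) (c q : Fin I → Fin J → ℝ)
    (p : Fin J → ℝ) : ℝ :=
  welfare u c q + ∑ j, p j * (Q j - ∑ i, q i j)

/-- `(q, p)` is an equilibrium: `q` solves the social welfare problem, and `p` is a vector of
Lagrange multipliers for its resource constraints at `q`, that is, `q` maximizes the Lagrangian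
with multipliers `p` over all nonnegative demand vectors. -/
structure IsEquilibrium (u : Fin I → ℝ → ℝ) (Q : Fin J → ℝ) (c q : Fin I → Fin J → ℝ)
    (p : Fin J → ℝ) : Prop where
  mem_feasible : q ∈ feasible I Q
  isMaxOn_welfare : IsMaxOn (welfare u c) (feasible I Q) q
  isMaxOn_lagrangian : IsMaxOn (fun q' => lagrangian u Q c q' p) (nonnegDemand I J) q

/-- The projection `(x)_y^+`, equal to `x` if `y > 0` and to `max 0 x` if `y ≤ 0`. -/
def projPlus (x y : ℝ) : ℝ := if 0 < y then x else max 0 x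

/-- Marginal utility `f_ij = c_ij u_i'(x_i)` (one-sided derivative at `x_i = 0`). -/
def margUtil (u : Fin I → ℝ → ℝ) (c q : Fin I → Fin J → ℝ) (i : Fin I) (j : Fin J) : ℝ :=
  c i j * derivWithin (u i) (Ici 0) (effRes c q i)

/-- Solution trajectories on `[0, ∞)` of the primal-dual dynamics with nonnegative initial values.
The right-hand side is discontinuous, so solutions are in the sense of Carathéodory: locally
absolutely continuous, with the equations holding at almost every time (and with the marginal
utilities that occur in them existing at almost every time). -/
structure IsTrajectory (u : Fin I → ℝ → ℝ) (Q : Fin J → ℝ) (c : Fin I → Fin J → ℝ)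
    (kq : Fin I → Fin J → ℝ) (kp : Fin J → ℝ)
    (q : ℝ → Fin I → Fin J → ℝ) (p : ℝ → Fin J → ℝ) : Prop where
  demand_init : ∀ i j, 0 ≤ q 0 i j
  price_init : ∀ j, 0 ≤ p 0 j
  demand_ac : ∀ i j, ∀ T : ℝ, 0 ≤ T → AbsolutelyContinuousOnInterval (fun t => q t i j) 0 T
  price_ac : ∀ j, ∀ T : ℝ, 0 ≤ T → AbsolutelyContinuousOnInterval (fun t => p t j) 0 T
  marginal_exists : ∀ᵐ t ∂(volume.restrict (Ici (0 : ℝ))), ∀ i,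
    DifferentiableWithinAt ℝ (u i) (Ici 0) (effRes c (q t) i)
  demand_eq : ∀ᵐ t ∂(volume.restrict (Ici (0 : ℝ))), ∀ i j,
    HasDerivAt (fun s => q s i j)
      (kq i j * projPlus (margUtil u c (q t) i j - p t j) (q t i j)) t
  price_eq : ∀ᵐ t ∂(volume.restrict (Ici (0 : ℝ))), ∀ j,
    HasDerivAt (fun s => p s j)
      (kp j * projPlus (∑ i, q t i j - Q j) (p t j)) t

end ProviderCompetition

end

noncomputable section

namespace ProviderCompetition

/-! Call an edge $(i,j)$ tight if $c_{ij}u_i'(x_i^*)=p_j^*$. On tight edges $\log c_{ij}$ is a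
difference of potentials, so its pairing with any circulation supported there is zero. For
independent atomless offsets this pairing is almost surely nonzero for a circulation fixed
beforehand, and there are only finitely many edge sets; hence tight edges almost surely form a
forest (`ae_hasForestSupports`). Strict concavity fixes the effective resources, and on a forest
these and the supplies determine the demands (`IsKKT.demand_unique`). This gives uniqueness.

For convergence, the weighted squared distance $V$ to the equilibrium decreases along trajectories.
Its dissipation forces $x_i\to x_i^*$, sends demands on non-tight edges to $0$, and makes the
cumulative effect of the projections vanish for prices and for demands with $q^*_{ij}>0$. Limits of
time translates (`exists_limitFlow`) therefore have constant $V$ and, after a second passage to the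
limit (`IsLimitFlow.exists_parallel`), obey unprojected linear equations on all tight edges. There
$w_j=p_j-p_j^*$ satisfies $w_j''=-k\,k^p_j d_j w_j$, with $d_j$ the number of tight edges at $j$,
and constancy of $x_i$ gives $\sum_{j\text{ tight}}c_{ij}w_j=0$ at each user.

Oscillations of distinct frequencies are linearly independent. At a user where all but one of the
moving providers have $d_j=1$, a coincidence of frequencies would make one price rate an integer
multiple of another. The forest supplies such a user whenever some $w_j$ is nonzero
(`oscillators_eq_zero`). So the limit flow rests at the equilibrium, the limit of $V$ is $0$, and
the whole trajectory converges. -/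

/-! ### Generic offsets and circulations on bipartite graphs. -/

/-- A nontrivial linear combination of the logarithms of independent atomless random variables
almost surely does not vanish. -/
theorem ae_sum_mul_log_ne_zero {Ω ι : Type*} [Fintype ι] [MeasurableSpace Ω] {μ : Measure Ω}
    [IsProbabilityMeasure μ] {X : ι → Ω → ℝ} (hX : ∀ e, Measurable (X e)) (hind : iIndepFun X μ)
    (hatom : ∀ e x, μ {ω | X e ω = x} = 0) {y : ι → ℝ} (hy : y ≠ 0) :
    ∀ᵐ ω ∂μ, ∑ e, y e * Real.log (X e ω) ≠ 0 := by
  classical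
  obtain ⟨e₀, he₀⟩ : ∃ e, y e ≠ 0 := by
    by_contra! h
    exact hy (funext h)
  set Y : Ω → ℝ := fun ω => ∑ e ∈ Finset.univ.erase e₀, y e * Real.log (X e ω) with hYdef
  have hYm : Measurable Y := Finset.measurable_sum _ fun e _ =>
    (Real.measurable_log.comp (hX e)).const_mul _
  have hXY : IndepFun (X e₀) Y μ := by
    have h := hind.indepFun_finset {e₀} (Finset.univ.erase e₀) (by simp) hX
    have hm : Measurable fun a : ({e₀} : Finset ι) → ℝ => a ⟨e₀, by simp⟩ :=
      measurable_pi_apply _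
    have h2 := h.comp
      (ψ := fun a : ↥(Finset.univ.erase e₀) → ℝ => ∑ e, y e.1 * Real.log (a e))
      hm
      (Finset.measurable_sum _ fun e _ =>
        (Real.measurable_log.comp (measurable_pi_apply e)).const_mul _)
    have hY : Y = (fun a : ↥(Finset.univ.erase e₀) → ℝ => ∑ e, y e.1 * Real.log (a e)) ∘
        fun ω e => X e.1 ω :=
      funext fun ω =>
        (Finset.sum_coe_sort (Finset.univ.erase e₀) fun e => y e * Real.log (X e ω)).symm
    rw [hY]
    exact h2
  -- Independence turns the joint law of the remaining sum and `X e₀` into a product, so by Fubini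
  -- it suffices that each section in the variable `X e₀` is null.
  have hprod := (indepFun_iff_map_prod_eq_prod_map_map hYm.aemeasurable
    (hX e₀).aemeasurable).1 hXY.symm
  set S : Set (ℝ × ℝ) := {z | y e₀ * Real.log z.2 + z.1 = 0} with hSdef
  have hS : MeasurableSet S :=
    measurableSet_eq_fun (((Real.measurable_log.comp measurable_snd).const_mul _).add
      measurable_fst) measurable_const
  have h0 : (μ.map (fun ω => (Y ω, X e₀ ω))) S = 0 := by
    rw [hprod, Measure.measure_prod_null hS]
    refine Eventually.of_forall fun b => ?_
    have hpt : ∀ x, μ.map (X e₀) {x} = 0 := fun x => by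
      rw [Measure.map_apply (hX e₀) (measurableSet_singleton x)]
      exact hatom e₀ x
    -- `Real.log` is even and takes the value $0$ at $0$, so prescribing the logarithm leaves at
    -- most these three points.
    have hfin : (μ.map (X e₀)) {0, Real.exp (-b / y e₀), -Real.exp (-b / y e₀)} = 0 := by
      rw [← Set.biUnion_of_singleton {0, Real.exp (-b / y e₀), -Real.exp (-b / y e₀)}]
      exact (measure_biUnion_null_iff (Set.toFinite _).countable).2 fun x _ => hpt x
    refine measure_mono_null (fun a ha => ?_) hfin
    have hlog : Real.log a = -b / y e₀ := by
      have : y e₀ * Real.log a + b = 0 := ha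
      field_simp
      linarith
    by_cases ha0 : a = 0
    · simp [ha0]
    · have := Real.exp_log_eq_abs ha0
      rw [hlog] at this
      rcases abs_choice a with h | h
      · right; left; rw [this, h]
      · right; right; rw [Set.mem_singleton_iff, this, h, neg_neg]
  rw [Measure.map_apply (hYm.prodMk (hX e₀)) hS] at h0
  refine measure_mono_null (fun ω hω => ?_) h0
  have hω' : ∑ e, y e * Real.log (X e ω) = 0 := not_not.1 hω
  rw [← Finset.add_sum_erase Finset.univ _ (Finset.mem_univ e₀)] at hω'
  exact hω'

variable {I J : ℕ}

/-- For all positive potentials `lam`, `p`, the edges with `c i j * lam i = p j` carry no nonzero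
circulation; equivalently, they form a forest. -/
def HasForestSupports (c : Fin I → Fin J → ℝ) : Prop :=
  ∀ (lam : Fin I → ℝ) (p : Fin J → ℝ), (∀ i, 0 < lam i) → (∀ j, 0 < p j) →
    ∀ y : Fin I → Fin J → ℝ, (∀ i j, y i j ≠ 0 → c i j * lam i = p j) →
      (∀ i, ∑ j, y i j = 0) → (∀ j, ∑ i, y i j = 0) → y = 0

/-- The potentials range over a continuum, but they matter only through their tight edge set, one of
finitely many. One test circulation is chosen per edge set, independently of the outcome, and only
these finitely many pairings with $\log c$ have to be nonzero. -/
theorem ae_hasForestSupports {Ω : Type*} [MeasurableSpace Ω] {μ : Measure Ω}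
    [IsProbabilityMeasure μ] {c : Fin I → Fin J → Ω → ℝ} (hc : ∀ i j, Measurable (c i j))
    (hind : iIndepFun (fun e : Fin I × Fin J => c e.1 e.2) μ)
    (hatom : ∀ i j x, μ {ω | c i j ω = x} = 0) (hpos : ∀ i j, ∀ᵐ ω ∂μ, 0 < c i j ω) :
    ∀ᵐ ω ∂μ, HasForestSupports fun i j => c i j ω := by
  classical
  have key : ∀ H : Finset (Fin I × Fin J), ∀ᵐ ω ∂μ,
      (∃ y : Fin I × Fin J → ℝ, y ≠ 0 ∧ (∀ e, y e ≠ 0 → e ∈ H) ∧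
        (∀ i, ∑ j, y (i, j) = 0) ∧ (∀ j, ∑ i, y (i, j) = 0)) →
      ∃ y : Fin I × Fin J → ℝ, (∀ e, y e ≠ 0 → e ∈ H) ∧
        (∀ i, ∑ j, y (i, j) = 0) ∧ (∀ j, ∑ i, y (i, j) = 0) ∧
        ∑ e, y e * Real.log (c e.1 e.2 ω) ≠ 0 := by
    intro H
    by_cases h : ∃ y : Fin I × Fin J → ℝ, y ≠ 0 ∧ (∀ e, y e ≠ 0 → e ∈ H) ∧
        (∀ i, ∑ j, y (i, j) = 0) ∧ (∀ j, ∑ i, y (i, j) = 0)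
    · obtain ⟨y, hy, h1, h2, h3⟩ := h
      filter_upwards [ae_sum_mul_log_ne_zero (X := fun e : Fin I × Fin J => c e.1 e.2)
        (fun e => hc e.1 e.2) hind (fun e => hatom e.1 e.2) hy] with ω hω _
      exact ⟨y, h1, h2, h3, hω⟩
    · exact Eventually.of_forall fun ω h' => absurd h' h
  have hpos' : ∀ᵐ ω ∂μ, ∀ i j, 0 < c i j ω :=
    ae_all_iff.2 fun i => ae_all_iff.2 fun j => hpos i j
  filter_upwards [ae_all_iff.2 key, hpos'] with ω hω hcpos lam p hlam hp y hsupp hrow hcol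
  by_contra hne
  obtain ⟨z, hz, hzr, hzc, hzs⟩ := hω
    (Finset.univ.filter fun e : Fin I × Fin J => c e.1 e.2 ω * lam e.1 = p e.2)
    ⟨fun e => y e.1 e.2, fun h => hne (funext fun i => funext fun j => congrFun h (i, j)),
      fun e he => by simpa using hsupp e.1 e.2 he, hrow, hcol⟩
  apply hzs
  -- On the support of `z`, $\log c_{ij}=\log p_j-\log\lambda_i$; summing against a circulation
  -- kills both terms.
  have h1 : ∀ e : Fin I × Fin J, z e * Real.log (c e.1 e.2 ω) =
      z e * Real.log (p e.2) - z e * Real.log (lam e.1) := by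
    intro e
    by_cases h0 : z e = 0
    · simp [h0]
    · have := hz e h0
      simp only [Finset.mem_filter, Finset.mem_univ, true_and] at this
      rw [← this, Real.log_mul (hcpos _ _).ne' (hlam _).ne']
      ring
  simp_rw [h1]
  rw [Finset.sum_sub_distrib, Fintype.sum_prod_type_right, Fintype.sum_prod_type]
  simp [← Finset.sum_mul, hzr, hzc]

/-- A nonempty set of edges of a bipartite graph in which every vertex has degree `0` or at least
`2` carries a nonzero circulation. -/
theorem exists_circulation {α β : Type*} [Fintype α] [Fintype β] (H : Finset (α × β))
    (hne : H.Nonempty)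
    (hrow : ∀ e ∈ H, ∃ b, b ≠ e.2 ∧ (e.1, b) ∈ H) (hcol : ∀ e ∈ H, ∃ a, a ≠ e.1 ∧ (a, e.2) ∈ H) :
    ∃ y : α → β → ℝ, y ≠ 0 ∧ (∀ a b, y a b ≠ 0 → (a, b) ∈ H) ∧
      (∀ a, ∑ b, y a b = 0) ∧ ∀ b, ∑ a, y a b = 0 := by
  classical
  set U := H.image Prod.fst with hU
  set P := H.image Prod.snd with hP
  have hUc : 2 * U.card ≤ H.card := by
    refine Finset.mul_card_image_le_card H 2 fun a ha => ?_
    obtain ⟨e, he, rfl⟩ := Finset.mem_image.1 ha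
    obtain ⟨b, hb, hbH⟩ := hrow e he
    exact Finset.one_lt_card.2 ⟨e, by simp [he], (e.1, b), by simp [hbH],
      fun h => hb (congrArg Prod.snd h).symm⟩
  have hPc : 2 * P.card ≤ H.card := by
    refine Finset.mul_card_image_le_card H 2 fun b hb => ?_
    obtain ⟨e, he, rfl⟩ := Finset.mem_image.1 hb
    obtain ⟨a, ha, haH⟩ := hcol e he
    exact Finset.one_lt_card.2 ⟨e, by simp [he], (a, e.2), by simp [haH],
      fun h => ha (congrArg Prod.fst h).symm⟩
  obtain ⟨e₀, he₀⟩ := hne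
  set ext : (H → ℝ) →ₗ[ℝ] (α → β → ℝ) :=
    { toFun := fun z a b => if h : (a, b) ∈ H then z ⟨(a, b), h⟩ else 0
      map_add' := fun z w => by
        ext a b; by_cases h : (a, b) ∈ H <;> simp [h]
      map_smul' := fun r z => by
        ext a b; by_cases h : (a, b) ∈ H <;> simp [h] } with hext
  -- Dimension count: $|H|$ unknowns against $|U|+|P|-1$ equations, where $2|U|,2|P|\le|H|$. One
  -- column equation is dropped because it follows from the others by double counting the total sum;
  -- without this saving the count could be an equality.
  set F : (H → ℝ) →ₗ[ℝ] (U → ℝ) × ((P.erase e₀.2 : Finset β) → ℝ) :=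
    { toFun := fun z => (fun a => ∑ b, ext z a b, fun b => ∑ a, ext z a b)
      map_add' := fun z w => by
        ext a <;> simp [Finset.sum_add_distrib]
      map_smul' := fun r z => by
        ext a <;> simp [Finset.mul_sum] } with hF
  have hker : LinearMap.ker F ≠ ⊥ := by
    have hmem : e₀.2 ∈ P := Finset.mem_image_of_mem _ he₀
    have hpos : 0 < P.card := Finset.card_pos.2 ⟨_, hmem⟩
    apply LinearMap.ker_ne_bot_of_finrank_lt
    simp only [Module.finrank_prod, Module.finrank_fintype_fun_eq_card, Fintype.card_coe,
      Finset.card_erase_of_mem hmem]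
    omega
  obtain ⟨z, hz, hz0⟩ := (Submodule.ne_bot_iff _).1 hker
  have hFz : F z = 0 := hz
  have hsupp : ∀ a b, ext z a b ≠ 0 → (a, b) ∈ H := fun a b h => by
    by_contra hab
    exact h (by simp [hext, hab])
  have hr : ∀ a, ∑ b, ext z a b = 0 := by
    intro a
    by_cases ha : a ∈ U
    · exact congrFun (congrArg Prod.fst hFz) ⟨a, ha⟩
    · refine Finset.sum_eq_zero fun b _ => ?_
      by_contra h
      exact ha (Finset.mem_image_of_mem Prod.fst (hsupp a b h))
  have hc' : ∀ b, b ≠ e₀.2 → ∑ a, ext z a b = 0 := by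
    intro b hb
    by_cases hbP : b ∈ P
    · exact congrFun (congrArg Prod.snd hFz) ⟨b, Finset.mem_erase.2 ⟨hb, hbP⟩⟩
    · refine Finset.sum_eq_zero fun a _ => ?_
      by_contra h
      exact hbP (Finset.mem_image_of_mem Prod.snd (hsupp a b h))
  refine ⟨ext z, fun h => hz0 ?_, hsupp, hr, fun b => ?_⟩
  · funext e
    have := congrFun (congrFun h e.1.1) e.1.2
    simpa [hext] using this
  · by_cases hb : b = e₀.2
    · have h1 : ∑ b, ∑ a, ext z a b = 0 := by
        rw [Finset.sum_comm]
        exact Finset.sum_eq_zero fun a _ => hr a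
      rw [Finset.sum_eq_single e₀.2 (fun b _ h => hc' b h) (by simp)] at h1
      rw [hb, h1]
    · exact hc' b hb

/-! ### Marginal utilities of strictly concave functions. -/

/-- Marginal utility, one-sided at `0`. -/
abbrev marginal (v : ℝ → ℝ) (x : ℝ) : ℝ := derivWithin v (Ici 0) x

namespace IsUtility

variable {v : ℝ → ℝ} (hv : IsUtility v)
include hv

theorem differentiableAt {x : ℝ} (hx : 0 < x) : DifferentiableAt ℝ v x :=
  (hv.differentiableOn x hx).differentiableAt (Ioi_mem_nhds hx)

theorem differentiableWithinAt {x : ℝ} (hx : 0 < x) : DifferentiableWithinAt ℝ v (Ici 0) x :=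
  (hv.differentiableAt hx).differentiableWithinAt

theorem hasDerivAt_marginal {x : ℝ} (hx : 0 < x) : HasDerivAt v (marginal v x) x :=
  (hv.differentiableWithinAt hx).hasDerivWithinAt.hasDerivAt (Ici_mem_nhds hx)

theorem marginal_pos {x : ℝ} (hx : 0 < x) : 0 < marginal v x := by
  have h := hv.strictConcaveOn.slope_lt_derivWithin (x := x) (y := x + 1) hx.le
    (by simp; linarith) (by linarith) (hv.differentiableWithinAt hx)
  refine lt_trans ?_ h
  rw [slope_def_field]
  have := hv.strictMonoOn (a := x) (b := x + 1) hx.le (by simp; linarith) (by linarith)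
  apply div_pos <;> linarith

theorem marginal_lt {x y : ℝ} (hx : 0 ≤ x) (hxy : x < y)
    (hd : DifferentiableWithinAt ℝ v (Ici 0) x) : marginal v y < marginal v x :=
  have hy : 0 < y := hx.trans_lt hxy
  (hv.strictConcaveOn.derivWithin_lt_slope hx hy.le hxy (hv.differentiableWithinAt hy)).trans
    (hv.strictConcaveOn.slope_lt_derivWithin hx hy.le hxy hd)

/-- Concavity bounds the derivative at `y` by secant slopes to a fixed point `z` on either side.
These slopes are continuous in `y`, and for `z` near `x` they are close to the derivative at `x`. -/
theorem continuousAt_marginal {x : ℝ} (hx : 0 < x) : ContinuousAt (marginal v) x := by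
  have hs := hasDerivAt_iff_tendsto_slope.1 (hv.hasDerivAt_marginal hx)
  have hcont : ContinuousAt v x := (hv.differentiableAt hx).continuousAt
  have hslope : ∀ z, z ≠ x → Tendsto (fun y => slope v z y) (𝓝 x) (𝓝 (slope v z x)) := by
    intro z hz
    simp only [slope_def_field]
    exact (hcont.sub continuousAt_const).div (continuousAt_id.sub continuousAt_const)
      (sub_ne_zero.2 hz.symm)
  refine tendsto_order.2 ⟨fun a ha => ?_, fun a ha => ?_⟩
  · have h1 : ∀ᶠ z in 𝓝[>] x, a < slope v x z :=
      (hs.mono_left (nhdsWithin_mono _ fun z hz => (ne_of_gt hz))).eventually_const_lt ha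
    obtain ⟨z, hz, hxz⟩ := (h1.and self_mem_nhdsWithin).exists
    have hxz : x < z := hxz
    rw [slope_comm] at hz
    filter_upwards [(hslope z hxz.ne').eventually_const_lt hz, Ioo_mem_nhds hx hxz] with y hy hyz
    rw [slope_comm] at hy
    exact hy.trans (hv.strictConcaveOn.slope_lt_derivWithin hyz.1.le (hx.trans hxz).le hyz.2
      (hv.differentiableWithinAt hyz.1))
  · have h1 : ∀ᶠ z in 𝓝[<] x, slope v x z < a :=
      (hs.mono_left (nhdsWithin_mono _ fun z hz => (ne_of_lt hz))).eventually_lt_const ha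
    obtain ⟨z, ⟨hz, hzx⟩, hz0⟩ := ((h1.and self_mem_nhdsWithin).and
      (nhdsWithin_le_nhds (Ioi_mem_nhds hx))).exists
    have hzx : z < x := hzx
    have hz0 : 0 < z := hz0
    rw [slope_comm] at hz
    filter_upwards [(hslope z hzx.ne).eventually_lt_const hz, Ioi_mem_nhds hzx] with y hy hyz
    exact (hv.strictConcaveOn.derivWithin_lt_slope hz0.le (hz0.trans hyz).le hyz
      (hv.differentiableWithinAt (hz0.trans hyz))).trans hy

theorem mul_sub_marginal_nonneg {x y : ℝ} (hx : 0 ≤ x) (hy : 0 < y)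
    (hd : DifferentiableWithinAt ℝ v (Ici 0) x) :
    0 ≤ (x - y) * (marginal v y - marginal v x) := by
  rcases lt_trichotomy x y with h | h | h
  · have := hv.marginal_lt hx h hd
    nlinarith
  · simp [h]
  · have := hv.marginal_lt hy.le h (hv.differentiableWithinAt hy)
    nlinarith

theorem exists_le_mul_sub_marginal {y ε : ℝ} (hy : 0 < y) (hε : 0 < ε) :
    ∃ δ > 0, ∀ x, 0 ≤ x → DifferentiableWithinAt ℝ v (Ici 0) x → ε ≤ |x - y| →
      δ ≤ (x - y) * (marginal v y - marginal v x) := by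
  -- The cap $y/2$ keeps $y-\varepsilon'$ positive, where `v` is differentiable; the gaps at
  -- $y\pm\varepsilon'$ then bound all farther points by monotonicity.
  set ε' := min ε (y / 2) with hε'
  have h0 : 0 < ε' := lt_min hε (by linarith)
  have h1 : ε' ≤ y / 2 := min_le_right _ _
  have hup := hv.marginal_lt hy.le (show y < y + ε' by linarith) (hv.differentiableWithinAt hy)
  have hlo := hv.marginal_lt (x := y - ε') (by linarith) (show y - ε' < y by linarith)
    (hv.differentiableWithinAt (by linarith))
  refine ⟨ε' * min (marginal v y - marginal v (y + ε')) (marginal v (y - ε') - marginal v y),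
    mul_pos h0 (lt_min (by linarith) (by linarith)), fun x hx hd hxy => ?_⟩
  have hxy' : ε' ≤ |x - y| := (min_le_left _ _).trans hxy
  rcases le_abs.1 hxy' with h | h
  · have hm : marginal v x ≤ marginal v (y + ε') := by
      rcases (show y + ε' ≤ x by linarith).eq_or_lt with h' | h'
      · rw [h']
      · exact (hv.marginal_lt (by linarith) h' (hv.differentiableWithinAt (by linarith))).le
    exact mul_le_mul h ((min_le_left _ _).trans (by linarith))
      (le_min (by linarith) (by linarith)) (by linarith)
  · have hm : marginal v (y - ε') ≤ marginal v x := by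
      rcases (show x ≤ y - ε' by linarith).eq_or_lt with h' | h'
      · rw [h']
      · exact (hv.marginal_lt hx h' hd).le
    rw [show (x - y) * (marginal v y - marginal v x) =
      (-(x - y)) * (marginal v x - marginal v y) by ring]
    exact mul_le_mul h ((min_le_right _ _).trans (by linarith))
      (le_min (by linarith) (by linarith)) (by linarith)

end IsUtility

/-! ### KKT conditions and uniqueness of the equilibrium. -/

/-- Karush-Kuhn-Tucker conditions at a demand vector that gives every user a positive resource. -/
structure IsKKT (u : Fin I → ℝ → ℝ) (Q : Fin J → ℝ) (c q : Fin I → Fin J → ℝ)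
    (p : Fin J → ℝ) : Prop where
  demand_nonneg : ∀ i j, 0 ≤ q i j
  supply : ∀ j, ∑ i, q i j = Q j
  effRes_pos : ∀ i, 0 < effRes c q i
  price_pos : ∀ j, 0 < p j
  marg_le : ∀ i j, c i j * marginal (u i) (effRes c q i) ≤ p j
  marg_eq : ∀ i j, 0 < q i j → c i j * marginal (u i) (effRes c q i) = p j

theorem effRes_add_single (c q : Fin I → Fin J → ℝ) (i i' : Fin I) (j : Fin J) (s : ℝ) :
    effRes c (q + Pi.single i (Pi.single j s)) i' =
      effRes c q i' + if i' = i then s * c i j else 0 := by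
  simp only [effRes, Pi.add_apply, add_mul, Finset.sum_add_distrib, add_right_inj]
  split_ifs with h
  · subst h
    simp [Pi.single_apply]
  · simp [h]

theorem lagrangian_add_single (u : Fin I → ℝ → ℝ) (Q : Fin J → ℝ) (c q : Fin I → Fin J → ℝ)
    (p : Fin J → ℝ) (i : Fin I) (j : Fin J) (s : ℝ) :
    lagrangian u Q c (q + Pi.single i (Pi.single j s)) p = lagrangian u Q c q p +
      (u i (effRes c q i + s * c i j) - u i (effRes c q i) - p j * s) := by
  have h1 : welfare u c (q + Pi.single i (Pi.single j s)) = welfare u c q +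
      (u i (effRes c q i + s * c i j) - u i (effRes c q i)) := by
    simp only [welfare, effRes_add_single]
    rw [← sub_eq_iff_eq_add', ← Finset.sum_sub_distrib, Finset.sum_eq_single i]
    · simp
    · intro b _ hb
      simp [hb]
    · simp
  have h2 : ∑ j', p j' * (Q j' - ∑ i', (q + Pi.single i (Pi.single j s) : Fin I → Fin J → ℝ) i' j') =
      ∑ j', p j' * (Q j' - ∑ i', q i' j') - p j * s := by
    rw [sub_eq_add_neg, ← sub_eq_iff_eq_add', ← Finset.sum_sub_distrib, Finset.sum_eq_single j]
    · have : ∑ x, (Pi.single i (Pi.single j s) : Fin I → Fin J → ℝ) x j = s := by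
        rw [Finset.sum_eq_single i] <;> simp +contextual
      simp only [Pi.add_apply, Finset.sum_add_distrib, this]
      ring
    · intro b _ hb
      have : ∑ x, (Pi.single i (Pi.single j s) : Fin I → Fin J → ℝ) x b = 0 := by
        refine Finset.sum_eq_zero fun x _ => ?_
        by_cases hx : x = i
        · subst hx; simp [hb]
        · simp [hx]
      simp only [Pi.add_apply, Finset.sum_add_distrib, this]
      ring
    · simp
  simp only [lagrangian, h1, h2]
  ring

/-- Changing one coordinate of the demand by $s\ge -q_{ij}$ cannot raise the Lagrangian. The right
derivative at $s=0$ gives the inequality; if $q_{ij}>0$, then $s=0$ is an interior maximum and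
equality holds. Price positivity follows from the inequality at any user, and positive supply
guarantees that there is one. -/
theorem IsEquilibrium.isKKT {u : Fin I → ℝ → ℝ} {Q : Fin J → ℝ} {c q : Fin I → Fin J → ℝ}
    {p : Fin J → ℝ} (h : IsEquilibrium u Q c q p) (hu : ∀ i, IsUtility (u i))
    (hQ : ∀ j, 0 < Q j) (hc : ∀ i j, 0 < c i j) (hx : ∀ i, 0 < effRes c q i) :
    IsKKT u Q c q p := by
  have hq0 : ∀ i j, 0 ≤ q i j := h.mem_feasible.1
  have hmax : ∀ i j s, -q i j ≤ s →
      u i (effRes c q i + s * c i j) - p j * s ≤ u i (effRes c q i) := by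
    intro i j s hs
    have hmem : q + Pi.single i (Pi.single j s) ∈ nonnegDemand I J := by
      intro i' j'
      by_cases hi : i' = i
      · subst hi
        by_cases hj : j' = j
        · subst hj
          simp; linarith
        · simp [hj, hq0]
      · simp [hi, hq0]
    have := h.isMaxOn_lagrangian hmem
    simp only [Set.mem_ofPred_eq, lagrangian_add_single] at this
    linarith
  have hder : ∀ i j, HasDerivAt (fun s => u i (effRes c q i + s * c i j) - p j * s)
      (c i j * marginal (u i) (effRes c q i) - p j) 0 := by
    intro i j
    have h1 : HasDerivAt (fun s => effRes c q i + s * c i j) (c i j) 0 := by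
      simpa using ((hasDerivAt_id (0 : ℝ)).mul_const (c i j)).const_add (effRes c q i)
    have h2 : HasDerivAt (u i) (marginal (u i) (effRes c q i)) (effRes c q i + 0 * c i j) := by
      simpa using (hu i).hasDerivAt_marginal (hx i)
    have h3 := (h2.comp (0 : ℝ) h1).sub ((hasDerivAt_id (0 : ℝ)).const_mul (p j))
    rw [mul_comm (c i j)]
    simpa only [mul_one] using! h3
  have hle : ∀ i j, c i j * marginal (u i) (effRes c q i) ≤ p j := by
    intro i j
    have h1 := (hder i j).tendsto_slope_zero_right
    have := le_of_tendsto h1 (b := 0) (by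
      filter_upwards [self_mem_nhdsWithin] with s hs
      have hs : 0 < s := hs
      have := hmax i j s (by linarith [hq0 i j])
      simp only [zero_add, zero_mul, add_zero, mul_zero, sub_zero, smul_eq_mul]
      exact mul_nonpos_of_nonneg_of_nonpos (by positivity) (by linarith))
    linarith
  have hpp : ∀ j, ∃ i, 0 < q i j := by
    intro j
    by_contra! hcon
    have := Finset.sum_nonpos (s := Finset.univ) fun i _ => hcon i
    rw [h.mem_feasible.2 j] at this
    linarith [hQ j]
  refine ⟨hq0, h.mem_feasible.2, hx, fun j => ?_, hle, fun i j hq => ?_⟩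
  · obtain ⟨i, -⟩ := hpp j
    exact (mul_pos (hc i j) ((hu i).marginal_pos (hx i))).trans_le (hle i j)
  · have hloc : IsLocalMax (fun s => u i (effRes c q i + s * c i j) - p j * s) 0 := by
      filter_upwards [Ioi_mem_nhds (show -q i j < 0 by linarith)] with s hs
      have := hmax i j s (le_of_lt hs)
      simpa using this
    linarith [hloc.hasDerivAt_eq_zero (hder i j)]

theorem effRes_pos_of_pos {c q : Fin I → Fin J → ℝ} (hc : ∀ i j, 0 < c i j)
    (hq : ∀ i j, 0 ≤ q i j) {i : Fin I} {j : Fin J} (h : 0 < q i j) : 0 < effRes c q i :=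
  Finset.sum_pos' (fun j _ => mul_nonneg (hq i j) (hc i j).le)
    ⟨j, Finset.mem_univ _, mul_pos h (hc i j)⟩

theorem effRes_nonneg {c q : Fin I → Fin J → ℝ} (hc : ∀ i j, 0 < c i j)
    (hq : ∀ i j, 0 ≤ q i j) (i : Fin I) : 0 ≤ effRes c q i :=
  Finset.sum_nonneg fun j _ => mul_nonneg (hq i j) (hc i j).le

/-- The effective resources at a solution of the social welfare problem are unique. -/
theorem effRes_eq_of_isMaxOn {u : Fin I → ℝ → ℝ} (hu : ∀ i, IsUtility (u i)) {Q : Fin J → ℝ}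
    {c q q' : Fin I → Fin J → ℝ} (hc : ∀ i j, 0 < c i j) (hq : q ∈ feasible I Q)
    (hq' : q' ∈ feasible I Q) (hmax : IsMaxOn (welfare u c) (feasible I Q) q)
    (hmax' : IsMaxOn (welfare u c) (feasible I Q) q') (i : Fin I) :
    effRes c q' i = effRes c q i := by
  by_contra hne
  -- If the effective resources differed, the midpoint would be feasible with strictly larger
  -- welfare.
  set m : Fin I → Fin J → ℝ := fun i j => (1 / 2) * q i j + (1 / 2) * q' i j with hm
  have hmf : m ∈ feasible I Q := by
    refine ⟨fun i j => ?_, fun j => ?_⟩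
    · have := hq.1 i j
      have := hq'.1 i j
      simp only [hm]; linarith
    · simp only [hm, Finset.sum_add_distrib, ← Finset.mul_sum, hq.2 j, hq'.2 j]
      ring
  have hmx : ∀ i, effRes c m i = (1 / 2 : ℝ) • effRes c q i + (1 / 2 : ℝ) • effRes c q' i := by
    intro i
    simp only [effRes, hm, add_mul, Finset.sum_add_distrib, smul_eq_mul, Finset.mul_sum, mul_assoc]
  have hlt : ∑ i, ((1 / 2 : ℝ) • u i (effRes c q i) + (1 / 2 : ℝ) • u i (effRes c q' i)) <
      welfare u c m := by
    refine Finset.sum_lt_sum (fun k _ => ?_) ⟨i, Finset.mem_univ _, ?_⟩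
    · rw [hmx]
      exact (hu k).strictConcaveOn.concaveOn.2 (effRes_nonneg hc hq.1 k)
        (effRes_nonneg hc hq'.1 k) (by norm_num) (by norm_num) (by norm_num)
    · rw [hmx]
      exact (hu i).strictConcaveOn.2 (effRes_nonneg hc hq.1 i)
        (effRes_nonneg hc hq'.1 i) (Ne.symm hne) (by norm_num) (by norm_num) (by norm_num)
  have h1 : welfare u c m ≤ welfare u c q := hmax hmf
  have h2 : welfare u c m ≤ welfare u c q' := hmax' hmf
  simp only [Finset.sum_add_distrib, smul_eq_mul, ← Finset.mul_sum] at hlt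
  change (1 / 2) * welfare u c q + (1 / 2) * welfare u c q' < _ at hlt
  linarith

/-- A demand vector supported on the edges of a KKT point is determined by the supplies and the
effective resources. -/
theorem IsKKT.demand_unique {u : Fin I → ℝ → ℝ} (hu : ∀ i, IsUtility (u i)) {Q : Fin J → ℝ}
    {c q q' : Fin I → Fin J → ℝ} {p : Fin J → ℝ} (hforest : HasForestSupports c)
    (h : IsKKT u Q c q p)
    (hsupp : ∀ i j, c i j * marginal (u i) (effRes c q i) ≠ p j → q' i j = 0)
    (hsum : ∀ j, ∑ i, q' i j = Q j) (hx : ∀ i, effRes c q' i = effRes c q i) : q' = q := by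
  set lam : Fin I → ℝ := fun i => marginal (u i) (effRes c q i) with hlam
  have hq0 : ∀ i j, c i j * lam i ≠ p j → q i j = 0 := fun i j hne =>
    le_antisymm (not_lt.1 fun hlt => hne (h.marg_eq i j hlt)) (h.demand_nonneg i j)
  -- The weight $p_j$ makes the difference a circulation: on tight edges $p_j=c_{ij}\lambda_i$, so
  -- row sums are $\lambda_i$ times differences of effective resources, and column sums are $p_j$
  -- times differences of supplies.
  have h0 := hforest lam p (fun i => (hu i).marginal_pos (h.effRes_pos i)) h.price_pos
    (fun i j => p j * (q' i j - q i j)) (fun i j hne => ?_) (fun i => ?_) (fun j => ?_)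
  · funext i j
    have := congrFun (congrFun h0 i) j
    rcases mul_eq_zero.1 this with h' | h'
    · exact absurd h' (h.price_pos j).ne'
    · linarith
  · by_contra hcon
    exact hne (by rw [hsupp i j hcon, hq0 i j hcon]; ring)
  · have : ∀ j, p j * (q' i j - q i j) = lam i * (q' i j * c i j - q i j * c i j) := by
      intro j
      by_cases hcon : c i j * lam i = p j
      · rw [← hcon]; ring
      · rw [hsupp i j hcon, hq0 i j hcon]; ring
    simp_rw [this, ← Finset.mul_sum, Finset.sum_sub_distrib]
    have := hx i
    simp only [effRes] at this
    rw [this]; ring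
  · simp_rw [← Finset.mul_sum, Finset.sum_sub_distrib, hsum, h.supply]
    ring

/-- Both equilibria share their effective resources, hence their marginal utilities. A user buying
from `j` in one equilibrium attains that price, which is a lower bound for the other price; by
symmetry the prices agree, and the forest property gives the demands. -/
theorem IsEquilibrium.unique {u : Fin I → ℝ → ℝ} {Q : Fin J → ℝ} {c q q' : Fin I → Fin J → ℝ}
    {p p' : Fin J → ℝ} (h : IsEquilibrium u Q c q p) (h' : IsEquilibrium u Q c q' p')
    (hu : ∀ i, IsUtility (u i)) (hQ : ∀ j, 0 < Q j) (hc : ∀ i j, 0 < c i j)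
    (hforest : HasForestSupports c) (hx : ∀ i, 0 < effRes c q i) : q' = q ∧ p' = p := by
  have hxx := effRes_eq_of_isMaxOn hu hc h.mem_feasible h'.mem_feasible h.isMaxOn_welfare
    h'.isMaxOn_welfare
  have k := h.isKKT hu hQ hc hx
  have k' := h'.isKKT hu hQ hc fun i => by rw [hxx]; exact hx i
  have hle : ∀ {q q' : Fin I → Fin J → ℝ} {p p' : Fin J → ℝ}, IsKKT u Q c q p →
      IsKKT u Q c q' p' → (∀ i, effRes c q' i = effRes c q i) → ∀ j, p' j ≤ p j := by
    intro q q' p p' k k' hxx j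
    obtain ⟨i, hi⟩ : ∃ i, 0 < q' i j := by
      by_contra! hcon
      have := Finset.sum_nonpos (s := Finset.univ) fun i _ => hcon i
      rw [k'.supply j] at this
      linarith [hQ j]
    rw [← k'.marg_eq i j hi, hxx]
    exact k.marg_le i j
  have hp : p' = p := funext fun j =>
    le_antisymm (hle k k' hxx j) (hle k' k (fun i => (hxx i).symm) j)
  refine ⟨k.demand_unique hu hforest (fun i j hne => ?_) k'.supply hxx, hp⟩
  refine le_antisymm (not_lt.1 fun hlt => hne ?_) (k'.demand_nonneg i j)
  rw [← hxx, k'.marg_eq i j hlt, hp]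

/-! ### Absolutely continuous functions and a one-sided Barbalat lemma. -/

/-- Local absolute continuity on `[0, ∞)`. -/
def LocAC (f : ℝ → ℝ) : Prop := ∀ T : ℝ, 0 ≤ T → AbsolutelyContinuousOnInterval f 0 T

namespace LocAC

variable {f g : ℝ → ℝ}

theorem const (r : ℝ) : LocAC fun _ => r := fun _ _ =>
  (contDiff_const (c := r)).contDiffOn.absolutelyContinuousOnInterval

theorem add (hf : LocAC f) (hg : LocAC g) : LocAC fun t => f t + g t :=
  fun T hT => (hf T hT).add (hg T hT)

theorem neg (hf : LocAC f) : LocAC fun t => -f t := fun T hT => (hf T hT).neg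

theorem sub (hf : LocAC f) (hg : LocAC g) : LocAC fun t => f t - g t :=
  fun T hT => (hf T hT).sub (hg T hT)

theorem mul (hf : LocAC f) (hg : LocAC g) : LocAC fun t => f t * g t :=
  fun T hT => (hf T hT).mul (hg T hT)

theorem const_mul (r : ℝ) (hf : LocAC f) : LocAC fun t => r * f t :=
  fun T hT => (hf T hT).const_mul r

theorem sum {ι : Type*} {s : Finset ι} {F : ι → ℝ → ℝ} (h : ∀ i ∈ s, LocAC (F i)) :
    LocAC fun t => ∑ i ∈ s, F i t := by
  classical
  induction s using Finset.induction_on with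
  | empty => simpa using LocAC.const 0
  | insert a s ha ih =>
    simp only [Finset.sum_insert ha]
    exact (h a (by simp)).add (ih fun i hi => h i (by simp [hi]))

theorem continuousOn (hf : LocAC f) {a b : ℝ} (ha : 0 ≤ a) (hab : a ≤ b) :
    ContinuousOn f (Icc a b) := by
  refine (hf b (ha.trans hab)).continuousOn.mono ?_
  rw [uIcc_of_le (ha.trans hab)]
  exact Icc_subset_Icc_left ha

theorem sub_le_of_ae_deriv_le (hf : LocAC f) {a b M : ℝ} (ha : 0 ≤ a) (hab : a ≤ b)
    (h : ∀ᵐ t ∂(volume.restrict (Ici (0 : ℝ))), t ∈ Icc a b → ∃ f', HasDerivAt f f' t ∧ f' ≤ M) :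
    f b - f a ≤ M * (b - a) := by
  have hAC : AbsolutelyContinuousOnInterval f a b := by
    refine (hf b (ha.trans hab)).mono ?_
    rw [uIcc_of_le hab, uIcc_of_le (ha.trans hab)]
    exact Icc_subset_Icc_left ha
  rw [← hAC.integral_deriv_eq_sub]
  have h2 : ∫ _ in a..b, M = M * (b - a) := by
    rw [intervalIntegral.integral_const, smul_eq_mul, mul_comm]
  rw [← h2]
  refine intervalIntegral.integral_mono_ae_restrict hab hAC.intervalIntegrable_deriv
    intervalIntegrable_const ?_
  have hsub : Icc a b ⊆ Ici (0 : ℝ) := fun t ht => ha.trans ht.1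
  filter_upwards [ae_restrict_of_ae_restrict_of_subset hsub h,
    ae_restrict_mem measurableSet_Icc] with t ht htm
  obtain ⟨f', hf', hle⟩ := ht htm
  rwa [hf'.deriv]

/-- After the last time at which `f` is nonnegative, the projection makes the derivative
nonnegative, so `f` cannot descend to a negative value. -/
theorem nonneg_of_deriv_projPlus (hf : LocAC f) (h0 : 0 ≤ f 0) {κ : ℝ} (hκ : 0 ≤ κ) {a : ℝ → ℝ}
    (h : ∀ᵐ t ∂(volume.restrict (Ici (0 : ℝ))), HasDerivAt f (κ * projPlus (a t) (f t)) t)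
    {t : ℝ} (ht : 0 ≤ t) : 0 ≤ f t := by
  by_contra! hneg
  have hcont := hf.continuousOn le_rfl ht
  set S := Icc 0 t ∩ f ⁻¹' Ici 0 with hS
  have hSc : IsCompact S := isCompact_Icc.of_isClosed_subset
    (hcont.preimage_isClosed_of_isClosed isClosed_Icc isClosed_Ici) inter_subset_left
  obtain ⟨t₀, ⟨⟨h00, h0t⟩, hft₀⟩, hmax⟩ := hSc.exists_isGreatest ⟨0, ⟨le_rfl, ht⟩, h0⟩
  have hft₀ : 0 ≤ f t₀ := hft₀
  have hlt : t₀ < t := h0t.lt_of_ne fun h => by rw [h] at hft₀; linarith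
  have key : ∀ s, t₀ < s → s ≤ t → f s ≤ f t := by
    intro s hs hst
    have := hf.neg.sub_le_of_ae_deriv_le (M := 0) (h00.trans hs.le) hst (by
      filter_upwards [h] with r hr hrm
      refine ⟨_, hr.neg, ?_⟩
      have hfr : ¬ 0 < f r := fun hpos => by
        have := hmax ⟨⟨h00.trans (hs.le.trans hrm.1), hrm.2⟩, hpos.le⟩
        linarith [hrm.1]
      simp only [projPlus, hfr, if_false]
      have := mul_nonneg hκ (le_max_left 0 (a r))
      linarith)
    simp at this
    linarith
  have hle : f t₀ ≤ f t := by
    have hc : Tendsto f (𝓝[>] t₀) (𝓝 (f t₀)) := by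
      have := (hcont t₀ ⟨h00, h0t⟩).mono_left
        (nhdsWithin_mono t₀ (Ioc_subset_Icc_self.trans (Icc_subset_Icc_left h00)))
      rwa [nhdsWithin_Ioc_eq_nhdsGT hlt] at this
    refine le_of_tendsto hc ?_
    filter_upwards [Ioc_mem_nhdsGT hlt] with s hs
    exact key s hs.1 hs.2
  linarith

end LocAC

theorem exists_tendsto_of_antitone {V : ℝ → ℝ} {T : ℝ}
    (hV : ∀ a b, T ≤ a → a ≤ b → V b ≤ V a) (hV0 : ∀ t, T ≤ t → 0 ≤ V t) :
    ∃ l, Tendsto V atTop (𝓝 l) := by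
  have hanti : Antitone fun t => V (max t T) := fun a b hab =>
    hV _ _ (le_max_right _ _) (max_le_max_right _ hab)
  refine ⟨_, (tendsto_atTop_ciInf hanti ⟨0, ?_⟩).congr' ?_⟩
  · rintro _ ⟨t, rfl⟩
    exact hV0 _ (le_max_right _ _)
  · filter_upwards [eventually_ge_atTop T] with t ht
    rw [max_eq_left ht]

/-- A nonnegative function whose growth rate is bounded and whose size is controlled by the
dissipation of a nonnegative Lyapunov function tends to zero. -/
theorem tendsto_zero_of_dissipation {V y : ℝ → ℝ} {T L : ℝ} (hy : ∀ t, T ≤ t → 0 ≤ y t)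
    (hL : ∀ a b, T ≤ a → a ≤ b → y b - y a ≤ L * (b - a))
    (hV : ∀ a b, T ≤ a → a ≤ b → V b ≤ V a) (hV0 : ∀ t, T ≤ t → 0 ≤ V t)
    (hdis : ∀ ε > 0, ∃ δ > 0, ∀ a b, T ≤ a → a ≤ b → (∀ t ∈ Icc a b, ε ≤ y t) →
      V b + δ * (b - a) ≤ V a) : Tendsto y atTop (𝓝 0) := by
  obtain ⟨l, hl⟩ := exists_tendsto_of_antitone hV hV0
  set L' := max L 1 with hL'
  have hL'0 : 0 < L' := lt_of_lt_of_le one_pos (le_max_right _ _)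
  refine tendsto_order.2 ⟨fun a ha => ?_, fun ε hε => ?_⟩
  · filter_upwards [eventually_ge_atTop T] with t ht
    exact ha.trans_le (hy t ht)
  · obtain ⟨δ, hδ, hdrop⟩ := hdis (ε / 2) (by linarith)
    -- If $y(t)\ge\varepsilon$, the growth bound gives $y\ge\varepsilon/2$ on $[t-h,t]$, so `V`
    -- drops by at least $\delta h$ there; this contradicts convergence of `V` for large `t`.
    set h := ε / (2 * L') with hh
    have hh0 : 0 < h := by positivity
    have hlim : Tendsto (fun t => V (t - h) - V t) atTop (𝓝 0) := by
      have h1 : Tendsto (fun t : ℝ => t - h) atTop atTop :=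
        tendsto_atTop_add_const_right _ _ tendsto_id
      simpa using (hl.comp h1).sub hl
    filter_upwards [hlim.eventually_lt_const (show 0 < δ * h by positivity),
      eventually_ge_atTop (T + h)] with t ht htT
    by_contra! hcon
    have := hdrop (t - h) t (by linarith) (by linarith) fun s hs => by
      have h1 := hL s t (by linarith [hs.1]) hs.2
      have h2 : L * (t - s) ≤ L' * h := by
        have : L * (t - s) ≤ L' * (t - s) :=
          mul_le_mul_of_nonneg_right (le_max_left _ _) (by linarith [hs.2])
        have : L' * (t - s) ≤ L' * h := mul_le_mul_of_nonneg_left (by linarith [hs.1]) hL'0.le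
        linarith
      have h3 : L' * h = ε / 2 := by rw [hh]; field_simp
      linarith
    have h4 : δ * (t - (t - h)) = δ * h := by ring
    linarith

theorem mul_projPlus_sub {a y : ℝ} (hy : 0 ≤ y) : y * (projPlus a y - a) = 0 := by
  unfold projPlus
  split_ifs with h
  · simp
  · simp [le_antisymm (not_lt.1 h) hy]

theorem le_projPlus (a y : ℝ) : a ≤ projPlus a y := by
  unfold projPlus
  split_ifs
  exacts [le_rfl, le_max_right _ _]

theorem projPlus_le (a y : ℝ) : projPlus a y ≤ max 0 a := by
  unfold projPlus
  split_ifs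
  exacts [le_max_right _ _, le_rfl]

theorem abs_projPlus_le (a y : ℝ) : |projPlus a y| ≤ |a| :=
  abs_le.2 ⟨(neg_abs_le a).trans (le_projPlus a y),
    (projPlus_le a y).trans (max_le (abs_nonneg a) (le_abs_self a))⟩

/-! ### The Lyapunov function and its dissipation. -/

/-- A trajectory of the dynamics with equal demand update rates, together with a KKT point. -/
structure IsSetup (u : Fin I → ℝ → ℝ) (Q : Fin J → ℝ) (c qs : Fin I → Fin J → ℝ)
    (ps : Fin J → ℝ) (k : ℝ) (kp : Fin J → ℝ) (q : ℝ → Fin I → Fin J → ℝ)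
    (p : ℝ → Fin J → ℝ) : Prop where
  utility : ∀ i, IsUtility (u i)
  offset_pos : ∀ i j, 0 < c i j
  kkt : IsKKT u Q c qs ps
  rate_pos : 0 < k
  priceRate_pos : ∀ j, 0 < kp j
  traj : IsTrajectory u Q c (fun _ _ => k) kp q p

/-- Weighted squared distance to the point `(qs, ps)`. -/
def lyapunov (qs : Fin I → Fin J → ℝ) (ps : Fin J → ℝ) (k : ℝ) (kp : Fin J → ℝ)
    (q : Fin I → Fin J → ℝ) (p : Fin J → ℝ) : ℝ :=
  ∑ i, ∑ j, (2 * k)⁻¹ * ((q i j - qs i j) * (q i j - qs i j)) +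
    ∑ j, (2 * kp j)⁻¹ * ((p j - ps j) * (p j - ps j))

/-- Rate of decrease of the Lyapunov function. -/
def dissipation (u : Fin I → ℝ → ℝ) (Q : Fin J → ℝ) (c qs : Fin I → Fin J → ℝ) (ps : Fin J → ℝ)
    (q : Fin I → Fin J → ℝ) (p : Fin J → ℝ) : ℝ :=
  ∑ i, (effRes c q i - effRes c qs i) *
      (marginal (u i) (effRes c qs i) - marginal (u i) (effRes c q i)) +
    ∑ i, ∑ j, q i j * (ps j - c i j * marginal (u i) (effRes c qs i)) +
    ∑ i, ∑ j, qs i j * (projPlus (margUtil u c q i j - p j) (q i j) - (margUtil u c q i j - p j)) +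
    ∑ j, ps j * (projPlus (∑ i, q i j - Q j) (p j) - (∑ i, q i j - Q j))

/-- A nonnegative component `y` annihilates the projection excess `projPlus a y - a`, so the excess
enters only through the equilibrium component. The products of price and demand deviations cancel by
the saddle structure, and complementary slackness regroups the rest. -/
theorem lyapunov_deriv_eq {u : Fin I → ℝ → ℝ} {Q : Fin J → ℝ} {c qs : Fin I → Fin J → ℝ}
    {ps : Fin J → ℝ} (hk : IsKKT u Q c qs ps) {q : Fin I → Fin J → ℝ} {p : Fin J → ℝ}
    (hq : ∀ i j, 0 ≤ q i j) (hp : ∀ j, 0 ≤ p j) :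
    ∑ i, ∑ j, (q i j - qs i j) * projPlus (margUtil u c q i j - p j) (q i j) +
      ∑ j, (p j - ps j) * projPlus (∑ i, q i j - Q j) (p j) = -dissipation u Q c qs ps q p := by
  have h1 : ∀ {a y ys : ℝ}, 0 ≤ y →
      (y - ys) * projPlus a y = (y - ys) * a - ys * (projPlus a y - a) := by
    intro a y ys hy
    linear_combination mul_projPlus_sub (a := a) hy
  have h2 : ∀ i j, qs i j * (ps j - c i j * marginal (u i) (effRes c qs i)) = 0 := by
    intro i j
    rcases (hk.demand_nonneg i j).eq_or_lt with h | h
    · simp [← h]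
    · rw [hk.marg_eq i j h, sub_self, mul_zero]
  have h3 : ∑ j, (p j - ps j) * (∑ i, q i j - Q j) =
      ∑ i, ∑ j, (p j - ps j) * (q i j - qs i j) := by
    rw [Finset.sum_comm]
    refine Finset.sum_congr rfl fun j _ => ?_
    rw [← hk.supply j, ← Finset.sum_sub_distrib, Finset.mul_sum]
  have h4 : ∀ i, (effRes c q i - effRes c qs i) *
      (marginal (u i) (effRes c qs i) - marginal (u i) (effRes c q i)) =
      ∑ j, (q i j - qs i j) * c i j *
        (marginal (u i) (effRes c qs i) - marginal (u i) (effRes c q i)) := by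
    intro i
    rw [← Finset.sum_mul]
    simp only [effRes, sub_mul, Finset.sum_sub_distrib]
  have h5 : ∑ i, ∑ j, (q i j - qs i j) * (margUtil u c q i j - p j) +
      ∑ i, ∑ j, (p j - ps j) * (q i j - qs i j) =
      -(∑ i, ∑ j, (q i j - qs i j) * c i j *
        (marginal (u i) (effRes c qs i) - marginal (u i) (effRes c q i))) -
      ∑ i, ∑ j, q i j * (ps j - c i j * marginal (u i) (effRes c qs i)) := by
    simp only [← Finset.sum_add_distrib, ← Finset.sum_neg_distrib, ← Finset.sum_sub_distrib]
    refine Finset.sum_congr rfl fun i _ => Finset.sum_congr rfl fun j _ => ?_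
    simp only [margUtil]
    linear_combination h2 i j
  simp only [dissipation, h4]
  have h6 : ∀ i j, (q i j - qs i j) * projPlus (margUtil u c q i j - p j) (q i j) =
    (q i j - qs i j) * (margUtil u c q i j - p j) -
      qs i j * (projPlus (margUtil u c q i j - p j) (q i j) - (margUtil u c q i j - p j)) :=
    fun i j => h1 (hq i j)
  have h7 : ∀ j, (p j - ps j) * projPlus (∑ i, q i j - Q j) (p j) =
    (p j - ps j) * (∑ i, q i j - Q j) -
      ps j * (projPlus (∑ i, q i j - Q j) (p j) - (∑ i, q i j - Q j)) := fun j => h1 (hp j)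
  simp_rw [h6, h7, Finset.sum_sub_distrib]
  linear_combination h5 + h3

/-- All four groups of summands are nonnegative, by monotonicity of the marginals, by the KKT
inequality, and because projecting only increases a velocity. Hence the total dominates every single
summand, which is how it is exploited later. -/
theorem le_dissipation {u : Fin I → ℝ → ℝ} (hu : ∀ i, IsUtility (u i)) {Q : Fin J → ℝ}
    {c qs : Fin I → Fin J → ℝ} (hc : ∀ i j, 0 < c i j)
    {ps : Fin J → ℝ} (hk : IsKKT u Q c qs ps) {q : Fin I → Fin J → ℝ} {p : Fin J → ℝ}
    (hq : ∀ i j, 0 ≤ q i j)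
    (hd : ∀ i, DifferentiableWithinAt ℝ (u i) (Ici 0) (effRes c q i)) :
    0 ≤ dissipation u Q c qs ps q p ∧
    (∀ i, (effRes c q i - effRes c qs i) *
      (marginal (u i) (effRes c qs i) - marginal (u i) (effRes c q i)) ≤
        dissipation u Q c qs ps q p) ∧
    (∀ i j, q i j * (ps j - c i j * marginal (u i) (effRes c qs i)) ≤
      dissipation u Q c qs ps q p) ∧
    (∀ i j, qs i j * (projPlus (margUtil u c q i j - p j) (q i j) - (margUtil u c q i j - p j)) ≤
      dissipation u Q c qs ps q p) ∧
    ∀ j, ps j * (projPlus (∑ i, q i j - Q j) (p j) - (∑ i, q i j - Q j)) ≤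
      dissipation u Q c qs ps q p := by
  have n1 : ∀ i, 0 ≤ (effRes c q i - effRes c qs i) *
      (marginal (u i) (effRes c qs i) - marginal (u i) (effRes c q i)) := fun i =>
    (hu i).mul_sub_marginal_nonneg (effRes_nonneg hc hq i) (hk.effRes_pos i) (hd i)
  have n2 : ∀ i j, 0 ≤ q i j * (ps j - c i j * marginal (u i) (effRes c qs i)) := fun i j =>
    mul_nonneg (hq i j) (sub_nonneg.2 (hk.marg_le i j))
  have n3 : ∀ i j, 0 ≤ qs i j *
      (projPlus (margUtil u c q i j - p j) (q i j) - (margUtil u c q i j - p j)) := fun i j =>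
    mul_nonneg (hk.demand_nonneg i j) (sub_nonneg.2 (le_projPlus _ _))
  have n4 : ∀ j, 0 ≤ ps j * (projPlus (∑ i, q i j - Q j) (p j) - (∑ i, q i j - Q j)) := fun j =>
    mul_nonneg (hk.price_pos j).le (sub_nonneg.2 (le_projPlus _ _))
  have s1 := Finset.sum_nonneg fun i (_ : i ∈ Finset.univ) => n1 i
  have s2 := Finset.sum_nonneg fun i (_ : i ∈ Finset.univ) =>
    Finset.sum_nonneg fun j (_ : j ∈ Finset.univ) => n2 i j
  have s3 := Finset.sum_nonneg fun i (_ : i ∈ Finset.univ) =>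
    Finset.sum_nonneg fun j (_ : j ∈ Finset.univ) => n3 i j
  have s4 := Finset.sum_nonneg fun j (_ : j ∈ Finset.univ) => n4 j
  have single2 : ∀ {F : Fin I → Fin J → ℝ}, (∀ i j, 0 ≤ F i j) → ∀ i j, F i j ≤ ∑ i, ∑ j, F i j :=
    fun {F} hF i j => (Finset.single_le_sum (fun j _ => hF i j) (Finset.mem_univ j)).trans
      (Finset.single_le_sum (f := fun i => ∑ j, F i j)
        (fun i _ => Finset.sum_nonneg fun j _ => hF i j) (Finset.mem_univ i))
  refine ⟨?_, fun i => ?_, fun i j => ?_, fun i j => ?_, fun j => ?_⟩ <;> unfold dissipation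
  · linarith
  · linarith [Finset.single_le_sum (fun i _ => n1 i) (Finset.mem_univ i)]
  · linarith [single2 n2 i j]
  · linarith [single2 n3 i j]
  · linarith [Finset.single_le_sum (fun i _ => n4 i) (Finset.mem_univ j)]

namespace IsSetup

variable {u : Fin I → ℝ → ℝ} {Q : Fin J → ℝ} {c qs : Fin I → Fin J → ℝ} {ps : Fin J → ℝ} {k : ℝ}
  {kp : Fin J → ℝ} {q : ℝ → Fin I → Fin J → ℝ} {p : ℝ → Fin J → ℝ}

theorem demand_nonneg (S : IsSetup u Q c qs ps k kp q p) {t : ℝ} (ht : 0 ≤ t) (i : Fin I)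
    (j : Fin J) : 0 ≤ q t i j :=
  LocAC.nonneg_of_deriv_projPlus (f := fun t => q t i j) (S.traj.demand_ac i j)
    (S.traj.demand_init i j) S.rate_pos.le
    (a := fun t => margUtil u c (q t) i j - p t j)
    (by filter_upwards [S.traj.demand_eq] with t ht using ht i j) ht

theorem price_nonneg (S : IsSetup u Q c qs ps k kp q p) {t : ℝ} (ht : 0 ≤ t) (j : Fin J) :
    0 ≤ p t j :=
  LocAC.nonneg_of_deriv_projPlus (f := fun t => p t j) (S.traj.price_ac j)
    (S.traj.price_init j) (S.priceRate_pos j).le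
    (a := fun t => ∑ i, q t i j - Q j)
    (by filter_upwards [S.traj.price_eq] with t ht using ht j) ht

theorem locAC_lyapunov (S : IsSetup u Q c qs ps k kp q p) :
    LocAC fun t => lyapunov qs ps k kp (q t) (p t) := by
  have hq : ∀ i j, LocAC fun t => q t i j - qs i j := fun i j =>
    LocAC.sub (f := fun t => q t i j) (S.traj.demand_ac i j) (LocAC.const _)
  have hp : ∀ j, LocAC fun t => p t j - ps j := fun j =>
    LocAC.sub (f := fun t => p t j) (S.traj.price_ac j) (LocAC.const _)
  exact (LocAC.sum fun i _ => LocAC.sum fun j _ => ((hq i j).mul (hq i j)).const_mul _).add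
    (LocAC.sum fun j _ => ((hp j).mul (hp j)).const_mul _)

theorem locAC_effRes (S : IsSetup u Q c qs ps k kp q p) (i : Fin I) :
    LocAC fun t => effRes c (q t) i :=
  LocAC.sum fun j _ => LocAC.mul (f := fun t => q t i j) (S.traj.demand_ac i j) (LocAC.const _)

theorem ae_lyapunov (S : IsSetup u Q c qs ps k kp q p) :
    ∀ᵐ t ∂(volume.restrict (Ici (0 : ℝ))),
      HasDerivAt (fun t => lyapunov qs ps k kp (q t) (p t))
        (-dissipation u Q c qs ps (q t) (p t)) t := by
  filter_upwards [S.traj.demand_eq, S.traj.price_eq, ae_restrict_mem measurableSet_Ici]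
    with t hq hp ht
  rw [← lyapunov_deriv_eq S.kkt (fun i j => S.demand_nonneg ht i j) fun j => S.price_nonneg ht j]
  refine HasDerivAt.add (HasDerivAt.fun_sum fun i _ => HasDerivAt.fun_sum fun j _ => ?_)
    (HasDerivAt.fun_sum fun j _ => ?_)
  · have h := (hq i j).sub_const (qs i j)
    have h2 := (h.mul h).const_mul (2 * k)⁻¹
    refine h2.congr_deriv ?_
    have := S.rate_pos.ne'
    field_simp
    ring
  · have h := (hp j).sub_const (ps j)
    have h2 := (h.mul h).const_mul (2 * kp j)⁻¹
    refine h2.congr_deriv ?_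
    have := (S.priceRate_pos j).ne'
    field_simp
    ring

theorem ae_dissipation (S : IsSetup u Q c qs ps k kp q p) :
    ∀ᵐ t ∂(volume.restrict (Ici (0 : ℝ))), 0 ≤ dissipation u Q c qs ps (q t) (p t) ∧
    (∀ i, (effRes c (q t) i - effRes c qs i) *
      (marginal (u i) (effRes c qs i) - marginal (u i) (effRes c (q t) i)) ≤
        dissipation u Q c qs ps (q t) (p t)) ∧
    (∀ i j, q t i j * (ps j - c i j * marginal (u i) (effRes c qs i)) ≤
      dissipation u Q c qs ps (q t) (p t)) ∧
    (∀ i j, qs i j * (projPlus (margUtil u c (q t) i j - p t j) (q t i j) -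
      (margUtil u c (q t) i j - p t j)) ≤ dissipation u Q c qs ps (q t) (p t)) ∧
    ∀ j, ps j * (projPlus (∑ i, q t i j - Q j) (p t j) - (∑ i, q t i j - Q j)) ≤
      dissipation u Q c qs ps (q t) (p t) := by
  filter_upwards [S.traj.marginal_exists, ae_restrict_mem measurableSet_Ici] with t hd ht
  exact le_dissipation S.utility S.offset_pos S.kkt (fun i j => S.demand_nonneg ht i j) hd

theorem lyapunov_nonneg (S : IsSetup u Q c qs ps k kp q p) (t : ℝ) :
    0 ≤ lyapunov qs ps k kp (q t) (p t) := by
  have := S.rate_pos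
  have h := S.priceRate_pos
  refine add_nonneg (Finset.sum_nonneg fun i _ => Finset.sum_nonneg fun j _ => ?_)
    (Finset.sum_nonneg fun j _ => ?_)
  · exact mul_nonneg (by positivity) (mul_self_nonneg _)
  · have := h j
    exact mul_nonneg (by positivity) (mul_self_nonneg _)

theorem lyapunov_drop (S : IsSetup u Q c qs ps k kp q p) {a b δ : ℝ} (ha : 0 ≤ a) (hab : a ≤ b)
    (h : ∀ᵐ t ∂(volume.restrict (Ici (0 : ℝ))), t ∈ Icc a b →
      δ ≤ dissipation u Q c qs ps (q t) (p t)) :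
    lyapunov qs ps k kp (q b) (p b) + δ * (b - a) ≤ lyapunov qs ps k kp (q a) (p a) := by
  have := S.locAC_lyapunov.sub_le_of_ae_deriv_le (M := -δ) ha hab (by
    filter_upwards [h, S.ae_lyapunov] with t h1 h2 ht
    exact ⟨_, h2, neg_le_neg (h1 ht)⟩)
  linarith

theorem lyapunov_anti (S : IsSetup u Q c qs ps k kp q p) {a b : ℝ} (ha : 0 ≤ a) (hab : a ≤ b) :
    lyapunov qs ps k kp (q b) (p b) ≤ lyapunov qs ps k kp (q a) (p a) := by
  have := S.lyapunov_drop (δ := 0) ha hab (by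
    filter_upwards [S.ae_dissipation] with t h _ using h.1)
  linarith

end IsSetup

theorem sq_demand_le_lyapunov {qs : Fin I → Fin J → ℝ} {ps : Fin J → ℝ} {k : ℝ}
    {kp : Fin J → ℝ} (hk : 0 < k) (hkp : ∀ j, 0 < kp j) (q : Fin I → Fin J → ℝ) (p : Fin J → ℝ)
    (i : Fin I) (j : Fin J) : (q i j - qs i j) ^ 2 ≤ 2 * k * lyapunov qs ps k kp q p := by
  have h1 : ∀ i j, 0 ≤ (2 * k)⁻¹ * ((q i j - qs i j) * (q i j - qs i j)) := fun i j =>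
    mul_nonneg (by positivity) (mul_self_nonneg _)
  have h2 : ∀ j, 0 ≤ (2 * kp j)⁻¹ * ((p j - ps j) * (p j - ps j)) := fun j => by
    have := hkp j
    exact mul_nonneg (by positivity) (mul_self_nonneg _)
  have h3 : (2 * k)⁻¹ * ((q i j - qs i j) * (q i j - qs i j)) ≤ lyapunov qs ps k kp q p := by
    refine ((Finset.single_le_sum (fun j _ => h1 i j) (Finset.mem_univ j)).trans
      (Finset.single_le_sum (f := fun i => ∑ j, (2 * k)⁻¹ * ((q i j - qs i j) * (q i j - qs i j)))
        (fun i _ => Finset.sum_nonneg fun j _ => h1 i j) (Finset.mem_univ i))).trans ?_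
    exact le_add_of_nonneg_right (Finset.sum_nonneg fun j _ => h2 j)
  calc (q i j - qs i j) ^ 2 = 2 * k * ((2 * k)⁻¹ * ((q i j - qs i j) * (q i j - qs i j))) := by
        field_simp
    _ ≤ _ := mul_le_mul_of_nonneg_left h3 (by positivity)

theorem sq_price_le_lyapunov {qs : Fin I → Fin J → ℝ} {ps : Fin J → ℝ} {k : ℝ}
    {kp : Fin J → ℝ} (hk : 0 < k) (hkp : ∀ j, 0 < kp j) (q : Fin I → Fin J → ℝ) (p : Fin J → ℝ)
    (j : Fin J) : (p j - ps j) ^ 2 ≤ 2 * kp j * lyapunov qs ps k kp q p := by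
  have h1 : ∀ i j, 0 ≤ (2 * k)⁻¹ * ((q i j - qs i j) * (q i j - qs i j)) := fun i j =>
    mul_nonneg (by positivity) (mul_self_nonneg _)
  have h2 : ∀ j, 0 ≤ (2 * kp j)⁻¹ * ((p j - ps j) * (p j - ps j)) := fun j => by
    have := hkp j
    exact mul_nonneg (by positivity) (mul_self_nonneg _)
  have h3 : (2 * kp j)⁻¹ * ((p j - ps j) * (p j - ps j)) ≤ lyapunov qs ps k kp q p := by
    refine (Finset.single_le_sum (fun j _ => h2 j) (Finset.mem_univ j)).trans ?_
    exact le_add_of_nonneg_left (Finset.sum_nonneg fun i _ => Finset.sum_nonneg fun j _ => h1 i j)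
  have := hkp j
  calc (p j - ps j) ^ 2 = 2 * kp j * ((2 * kp j)⁻¹ * ((p j - ps j) * (p j - ps j))) := by
        field_simp
    _ ≤ _ := mul_le_mul_of_nonneg_left h3 (by positivity)

/-! ### Boundedness and convergence of effective resources. -/

namespace IsSetup

variable {u : Fin I → ℝ → ℝ} {Q : Fin J → ℝ} {c qs : Fin I → Fin J → ℝ} {ps : Fin J → ℝ} {k : ℝ}
  {kp : Fin J → ℝ} {q : ℝ → Fin I → Fin J → ℝ} {p : ℝ → Fin J → ℝ}

theorem exists_bound (S : IsSetup u Q c qs ps k kp q p) :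
    ∃ B, ∀ t, 0 ≤ t → (∀ i j, q t i j ≤ B) ∧ ∀ j, p t j ≤ B := by
  have hle : ∀ {x y M : ℝ}, (x - y) ^ 2 ≤ M → x ≤ 1 + M + y := by
    intro x y M h
    nlinarith [sq_nonneg (x - y - 1)]
  set V₀ := lyapunov qs ps k kp (q 0) (p 0)
  obtain ⟨B₁, hB₁⟩ := Finite.exists_le fun e : Fin I × Fin J => 1 + 2 * k * V₀ + qs e.1 e.2
  obtain ⟨B₂, hB₂⟩ := Finite.exists_le fun j : Fin J => 1 + 2 * kp j * V₀ + ps j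
  refine ⟨max B₁ B₂, fun t ht => ⟨fun i j => ?_, fun j => ?_⟩⟩
  · refine (hle ?_).trans ((hB₁ (i, j)).trans (le_max_left _ _))
    refine (sq_demand_le_lyapunov (ps := ps) S.rate_pos S.priceRate_pos (q t) (p t) i j).trans ?_
    exact mul_le_mul_of_nonneg_left (S.lyapunov_anti le_rfl ht) (by linarith [S.rate_pos])
  · refine (hle ?_).trans ((hB₂ j).trans (le_max_right _ _))
    refine (sq_price_le_lyapunov (qs := qs) S.rate_pos S.priceRate_pos (q t) (p t) j).trans ?_
    exact mul_le_mul_of_nonneg_left (S.lyapunov_anti le_rfl ht) (by linarith [S.priceRate_pos j])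

theorem tendsto_effRes (S : IsSetup u Q c qs ps k kp q p) (i : Fin I) :
    Tendsto (fun t => effRes c (q t) i) atTop (𝓝 (effRes c qs i)) := by
  obtain ⟨B, hB⟩ := S.exists_bound
  set xs := effRes c qs i with hxs
  have hxs0 : 0 < xs := S.kkt.effRes_pos i
  set lam := marginal (u i) xs with hlam
  have hlam0 : 0 < lam := (S.utility i).marginal_pos hxs0
  set C := ∑ j, c i j with hC
  have hC0 : 0 ≤ C := Finset.sum_nonneg fun j _ => (S.offset_pos i j).le
  have hcle : ∀ j, c i j ≤ C := fun j =>
    Finset.single_le_sum (f := fun j => c i j) (fun j _ => (S.offset_pos i j).le)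
      (Finset.mem_univ j)
  have hx0 : ∀ t, 0 ≤ t → 0 ≤ effRes c (q t) i := fun t ht =>
    effRes_nonneg S.offset_pos (fun i j => S.demand_nonneg ht i j) i
  have hxB : ∀ t, 0 ≤ t → effRes c (q t) i ≤ B * C := by
    intro t ht
    simp only [effRes, hC, Finset.mul_sum]
    exact Finset.sum_le_sum fun j _ =>
      mul_le_mul_of_nonneg_right ((hB t ht).1 i j) (S.offset_pos i j).le
  have hder : ∀ᵐ t ∂(volume.restrict (Ici (0 : ℝ))),
      HasDerivAt (fun t => effRes c (q t) i)
        (∑ j, k * projPlus (margUtil u c (q t) i j - p t j) (q t i j) * c i j) t := by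
    filter_upwards [S.traj.demand_eq] with t ht
    exact HasDerivAt.fun_sum fun j _ => (ht i j).mul_const _
  set L₁ := ∑ j, k * (C * lam) * c i j with hL₁
  set L₂ := ∑ j, k * max 0 B * c i j with hL₂
  have hL₁0 : 0 ≤ L₁ := Finset.sum_nonneg fun j _ =>
    mul_nonneg (mul_nonneg S.rate_pos.le (by positivity)) (S.offset_pos i j).le
  have hL₂0 : 0 ≤ L₂ := Finset.sum_nonneg fun j _ =>
    mul_nonneg (mul_nonneg S.rate_pos.le (le_max_left _ _)) (S.offset_pos i j).le
  have hsq : LocAC fun t => (effRes c (q t) i - xs) * (effRes c (q t) i - xs) :=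
    ((S.locAC_effRes i).sub (LocAC.const _)).mul ((S.locAC_effRes i).sub (LocAC.const _))
  have key : Tendsto (fun t => (effRes c (q t) i - xs) * (effRes c (q t) i - xs)) atTop (𝓝 0) := by
    refine tendsto_zero_of_dissipation (T := 0) (L := 2 * (B * C * L₁ + xs * L₂))
      (V := fun t => lyapunov qs ps k kp (q t) (p t))
      (fun t _ => mul_self_nonneg _) (fun a b ha hab => ?_)
      (fun a b ha hab => S.lyapunov_anti ha hab) (fun t _ => S.lyapunov_nonneg t)
      (fun ε hε => ?_)
    · refine hsq.sub_le_of_ae_deriv_le ha hab ?_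
      filter_upwards [hder, S.traj.marginal_exists, ae_restrict_mem measurableSet_Ici]
        with t h1 h2 ht _
      have hx := hx0 t ht
      have hxb := hxB t ht
      refine ⟨_, (h1.sub_const xs).mul (h1.sub_const xs), ?_⟩
      set X := effRes c (q t) i with hX
      set d := ∑ j, k * projPlus (margUtil u c (q t) i j - p t j) (q t i j) * c i j with hd
      -- The velocity of $x_i$ need not be bounded, since the marginal utility may blow up at $0$.
      -- Below `xs` a large marginal only pushes $x_i$ upwards, towards `xs`, so the squared
      -- deviation still has growth rate bounded above.
      suffices h : (X - xs) * d ≤ B * C * L₁ + xs * L₂ by linarith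
      have hm1 : 0 ≤ B * C * L₁ := mul_nonneg (hx.trans hxb) hL₁0
      have hm2 : 0 ≤ xs * L₂ := mul_nonneg hxs0.le hL₂0
      rcases le_total xs X with hle | hle
      · have hm : marginal (u i) X ≤ lam := by
          rcases hle.eq_or_lt with h | h
          · rw [← h]
          · exact ((S.utility i).marginal_lt hxs0.le h
              ((S.utility i).differentiableWithinAt hxs0)).le
        have hmX : 0 < marginal (u i) X := (S.utility i).marginal_pos (hxs0.trans_le hle)
        have hdle : d ≤ L₁ := by
          refine Finset.sum_le_sum fun j _ => mul_le_mul_of_nonneg_right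
            (mul_le_mul_of_nonneg_left ((projPlus_le _ _).trans (max_le (by positivity) ?_))
              S.rate_pos.le) (S.offset_pos i j).le
          have h3 : c i j * marginal (u i) X ≤ C * lam :=
            mul_le_mul (hcle j) hm hmX.le hC0
          have h4 := S.price_nonneg ht j
          simp only [margUtil]
          linarith
        calc (X - xs) * d ≤ (X - xs) * L₁ := mul_le_mul_of_nonneg_left hdle (by linarith)
          _ ≤ B * C * L₁ := mul_le_mul_of_nonneg_right (by linarith) hL₁0
          _ ≤ _ := by linarith
      · have hm : 0 ≤ marginal (u i) X := by
          rcases hle.eq_or_lt with h | h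
          · rw [h]; exact hlam0.le
          · exact hlam0.le.trans ((S.utility i).marginal_lt hx h (h2 i)).le
        have hdge : -L₂ ≤ d := by
          rw [hL₂, ← Finset.sum_neg_distrib]
          refine Finset.sum_le_sum fun j _ => ?_
          rw [← neg_mul, ← mul_neg]
          refine mul_le_mul_of_nonneg_right
            (mul_le_mul_of_nonneg_left (le_trans ?_ (le_projPlus _ _))
              S.rate_pos.le) (S.offset_pos i j).le
          have h3 : 0 ≤ c i j * marginal (u i) X := mul_nonneg (S.offset_pos i j).le hm
          have h4 := (hB t ht).2 j
          have h5 := le_max_right 0 B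
          simp only [margUtil]
          linarith
        calc (X - xs) * d = (xs - X) * (-d) := by ring
          _ ≤ (xs - X) * L₂ := mul_le_mul_of_nonneg_left (by linarith) (by linarith)
          _ ≤ xs * L₂ := mul_le_mul_of_nonneg_right (by linarith) hL₂0
          _ ≤ _ := by linarith
    · obtain ⟨δ, hδ, hδ'⟩ := (S.utility i).exists_le_mul_sub_marginal hxs0 (Real.sqrt_pos.2 hε)
      refine ⟨δ, hδ, fun a b ha hab hy => S.lyapunov_drop ha hab ?_⟩
      filter_upwards [S.ae_dissipation, S.traj.marginal_exists,
        ae_restrict_mem measurableSet_Ici] with t h1 h2 ht htab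
      refine (hδ' _ (hx0 t ht) (h2 i) ?_).trans (h1.2.1 i)
      rw [← Real.sqrt_mul_self_eq_abs]
      exact Real.sqrt_le_sqrt (hy t htab)
  have h1 : Tendsto (fun t => |effRes c (q t) i - xs|) atTop (𝓝 0) := by
    have := (Real.continuous_sqrt.tendsto 0).comp key
    simpa only [Function.comp_def, Real.sqrt_mul_self_eq_abs, Real.sqrt_zero] using this
  rw [tendsto_iff_dist_tendsto_zero]
  simpa only [Real.dist_eq] using h1

theorem tendsto_margUtil (S : IsSetup u Q c qs ps k kp q p) (i : Fin I) (j : Fin J) :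
    Tendsto (fun t => margUtil u c (q t) i j) atTop
      (𝓝 (c i j * marginal (u i) (effRes c qs i))) :=
  ((((S.utility i).continuousAt_marginal (S.kkt.effRes_pos i)).tendsto.comp
    (S.tendsto_effRes i)).const_mul _)

/-- From some time on, the trajectory is Lipschitz. -/
theorem exists_lipschitz (S : IsSetup u Q c qs ps k kp q p) :
    ∃ T L : ℝ, 0 ≤ T ∧ 0 ≤ L ∧ ∀ a b, T ≤ a → a ≤ b →
      (∀ i j, |q b i j - q a i j| ≤ L * (b - a)) ∧ ∀ j, |p b j - p a j| ≤ L * (b - a) := by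
  obtain ⟨B, hB⟩ := S.exists_bound
  -- Marginal utilities are controlled only eventually, once the effective resources are near their
  -- positive limits.
  have hev : ∀ᶠ t in atTop, ∀ i j,
      |margUtil u c (q t) i j| < |c i j * marginal (u i) (effRes c qs i)| + 1 :=
    eventually_all.2 fun i => eventually_all.2 fun j =>
      (S.tendsto_margUtil i j).abs.eventually_lt_const (by linarith)
  obtain ⟨T, hT⟩ := eventually_atTop.1 hev
  obtain ⟨F, hF⟩ := Finite.exists_le fun e : Fin I × Fin J =>
    k * (|c e.1 e.2 * marginal (u e.1) (effRes c qs e.1)| + 1 + max B 0)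
  obtain ⟨G, hG⟩ := Finite.exists_le fun j : Fin J => kp j * (∑ _i : Fin I, max B 0 + |Q j|)
  have habs : ∀ {f : ℝ → ℝ} {a b M : ℝ}, LocAC f → 0 ≤ a → a ≤ b →
      (∀ᵐ t ∂(volume.restrict (Ici (0 : ℝ))), t ∈ Icc a b →
        ∃ f', HasDerivAt f f' t ∧ |f'| ≤ M) → |f b - f a| ≤ M * (b - a) := by
    intro f a b M hf ha hab h
    refine abs_le'.2 ⟨hf.sub_le_of_ae_deriv_le ha hab ?_, ?_⟩
    · filter_upwards [h] with t ht hm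
      obtain ⟨f', h1, h2⟩ := ht hm
      exact ⟨f', h1, (le_abs_self _).trans h2⟩
    · have := hf.neg.sub_le_of_ae_deriv_le (M := M) ha hab (by
        filter_upwards [h] with t ht hm
        obtain ⟨f', h1, h2⟩ := ht hm
        exact ⟨-f', h1.neg, (neg_le_abs _).trans h2⟩)
      linarith
  refine ⟨max T 0, max 0 (max F G), le_max_right _ _, le_max_left _ _, fun a b ha hab => ?_⟩
  have haT := (le_max_left _ _).trans ha
  have ha0 := (le_max_right _ _).trans ha
  have hpabs : ∀ t, 0 ≤ t → ∀ j, |p t j| ≤ max B 0 := fun t ht j => by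
    rw [abs_of_nonneg (S.price_nonneg ht j)]
    exact ((hB t ht).2 j).trans (le_max_left _ _)
  have hqabs : ∀ t, 0 ≤ t → ∀ i j, |q t i j| ≤ max B 0 := fun t ht i j => by
    rw [abs_of_nonneg (S.demand_nonneg ht i j)]
    exact ((hB t ht).1 i j).trans (le_max_left _ _)
  refine ⟨fun i j => habs (f := fun t => q t i j) (S.traj.demand_ac i j) ha0 hab ?_,
    fun j => habs (f := fun t => p t j) (S.traj.price_ac j) ha0 hab ?_⟩
  · filter_upwards [S.traj.demand_eq, ae_restrict_mem measurableSet_Ici] with t ht ht0 htm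
    refine ⟨_, ht i j, ?_⟩
    rw [abs_mul, abs_of_pos S.rate_pos]
    refine le_trans (mul_le_mul_of_nonneg_left ?_ S.rate_pos.le)
      ((hF (i, j)).trans ((le_max_left _ _).trans (le_max_right _ _)))
    refine (abs_projPlus_le _ _).trans ((abs_sub _ _).trans ?_)
    linarith [hT t (haT.trans htm.1) i j, hpabs t ht0 j]
  · filter_upwards [S.traj.price_eq, ae_restrict_mem measurableSet_Ici] with t ht ht0 htm
    refine ⟨_, ht j, ?_⟩
    rw [abs_mul, abs_of_pos (S.priceRate_pos j)]
    refine le_trans (mul_le_mul_of_nonneg_left ?_ (S.priceRate_pos j).le)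
      ((hG j).trans ((le_max_right _ _).trans (le_max_right _ _)))
    refine (abs_projPlus_le _ _).trans ((abs_sub _ _).trans ?_)
    refine add_le_add_left ((Finset.abs_sum_le_sum_abs _ _).trans
      (Finset.sum_le_sum fun i _ => hqabs t ht0 i j)) _

theorem tendsto_demand_zero (S : IsSetup u Q c qs ps k kp q p) {i : Fin I} {j : Fin J}
    (hne : c i j * marginal (u i) (effRes c qs i) ≠ ps j) :
    Tendsto (fun t => q t i j) atTop (𝓝 0) := by
  obtain ⟨T, L, hT, hL, hLip⟩ := S.exists_lipschitz
  have hpos : 0 < ps j - c i j * marginal (u i) (effRes c qs i) :=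
    sub_pos.2 ((S.kkt.marg_le i j).lt_of_ne hne)
  refine tendsto_zero_of_dissipation (T := T) (L := L)
    (V := fun t => lyapunov qs ps k kp (q t) (p t))
    (fun t ht => S.demand_nonneg (hT.trans ht) i j)
    (fun a b ha hab => (le_abs_self _).trans ((hLip a b ha hab).1 i j))
    (fun a b ha hab => S.lyapunov_anti (hT.trans ha) hab) (fun t _ => S.lyapunov_nonneg t)
    (fun ε hε => ⟨_, mul_pos hε hpos, fun a b ha hab hy =>
      S.lyapunov_drop (hT.trans ha) hab ?_⟩)
  filter_upwards [S.ae_dissipation] with t h1 htab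
  exact (mul_le_mul_of_nonneg_right (hy t htab) hpos.le).trans (h1.2.2.1 i j)

end IsSetup

/-! ### Asymptotic disappearance of the projections. -/

namespace IsSetup

variable {u : Fin I → ℝ → ℝ} {Q : Fin J → ℝ} {c qs : Fin I → Fin J → ℝ} {ps : Fin J → ℝ} {k : ℝ}
  {kp : Fin J → ℝ} {q : ℝ → Fin I → Fin J → ℝ} {p : ℝ → Fin J → ℝ}

theorem exists_tendsto_lyapunov (S : IsSetup u Q c qs ps k kp q p) :
    ∃ l, Tendsto (fun t => lyapunov qs ps k kp (q t) (p t)) atTop (𝓝 l) :=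
  exists_tendsto_of_antitone (T := 0) (fun _ _ ha hab => S.lyapunov_anti ha hab)
    fun t _ => S.lyapunov_nonneg t

theorem eventually_lyapunov_sub_le (S : IsSetup u Q c qs ps k kp q p) {η : ℝ} (hη : 0 < η) :
    ∀ᶠ T in atTop, ∀ a b, T ≤ a → T ≤ b →
      lyapunov qs ps k kp (q a) (p a) - lyapunov qs ps k kp (q b) (p b) ≤ η := by
  obtain ⟨l, hl⟩ := S.exists_tendsto_lyapunov
  have h1 := hl.eventually_lt_const (show l < l + η / 2 by linarith)
  have h2 := hl.eventually_const_lt (show l - η / 2 < l by linarith)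
  filter_upwards [eventually_forall_ge_atTop.2 (h1.and h2)] with T hT a b ha hb
  linarith [(hT a ha).1, (hT b hb).2]

theorem eventually_margUtil_sub_le (S : IsSetup u Q c qs ps k kp q p) {i : Fin I} {j : Fin J}
    (hG : c i j * marginal (u i) (effRes c qs i) = ps j) {η : ℝ} (hη : 0 < η) :
    ∀ᶠ T in atTop, ∀ t, T ≤ t → |margUtil u c (q t) i j - ps j| ≤ η := by
  have h := (S.tendsto_margUtil i j)
  rw [hG] at h
  have h1 := (h.sub_const (ps j)).abs
  rw [sub_self, abs_zero] at h1
  filter_upwards [eventually_forall_ge_atTop.2 (h1.eventually_lt_const hη)] with T hT t ht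
  exact (hT t ht).le

/-- Where the equilibrium demand is positive, dissipation controls the projection excess itself. Its
time integral is then at most a multiple of the drop of the Lyapunov function, which tends to zero.
-/
theorem ae_proj_demand_le (S : IsSetup u Q c qs ps k kp q p) {i : Fin I} {j : Fin J}
    (hq : 0 < qs i j) : ∀ᵐ t ∂(volume.restrict (Ici (0 : ℝ))),
      k * projPlus (margUtil u c (q t) i j - p t j) (q t i j) ≤
        k * (margUtil u c (q t) i j - p t j) +
          k / qs i j * dissipation u Q c qs ps (q t) (p t) := by
  filter_upwards [S.ae_dissipation] with t ht
  have h1 := ht.2.2.2.1 i j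
  have h2 : k / qs i j * (qs i j * (projPlus (margUtil u c (q t) i j - p t j) (q t i j) -
      (margUtil u c (q t) i j - p t j))) ≤ k / qs i j * dissipation u Q c qs ps (q t) (p t) :=
    mul_le_mul_of_nonneg_left h1 (div_pos S.rate_pos hq).le
  rw [← mul_assoc, div_mul_cancel₀ _ hq.ne'] at h2
  linarith

theorem ae_proj_price_le (S : IsSetup u Q c qs ps k kp q p) (j : Fin J) :
    ∀ᵐ t ∂(volume.restrict (Ici (0 : ℝ))),
      kp j * projPlus (∑ i, q t i j - Q j) (p t j) ≤
        kp j * (∑ i, q t i j - Q j) +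
          kp j / ps j * dissipation u Q c qs ps (q t) (p t) := by
  filter_upwards [S.ae_dissipation] with t ht
  have h1 := ht.2.2.2.2 j
  have h2 : kp j / ps j * (ps j * (projPlus (∑ i, q t i j - Q j) (p t j) -
      (∑ i, q t i j - Q j))) ≤ kp j / ps j * dissipation u Q c qs ps (q t) (p t) :=
    mul_le_mul_of_nonneg_left h1 (div_pos (S.priceRate_pos j) (S.kkt.price_pos j)).le
  rw [← mul_assoc, div_mul_cancel₀ _ (S.kkt.price_pos j).ne'] at h2
  linarith

/-- Asymptotically, demands that are positive at the KKT point move without projection. -/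
theorem demand_remainder (S : IsSetup u Q c qs ps k kp q p) {i : Fin I} {j : Fin J}
    (hq : 0 < qs i j) :
    ∃ C, ∀ η > 0, ∀ᶠ T in atTop, ∀ a b τ, T ≤ a → a ≤ b → τ ∈ Icc a b →
      |q b i j - q a i j - (b - a) * (k * (ps j - p τ j))| ≤
        C * (b - a) ^ 2 + (η * (b - a) + η) := by
  obtain ⟨T₀, L, hT₀, hL, hLip⟩ := S.exists_lipschitz
  have hk := S.rate_pos
  refine ⟨k * L, fun η hη => ?_⟩
  filter_upwards [S.eventually_margUtil_sub_le (S.kkt.marg_eq i j hq) (div_pos hη hk),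
    S.eventually_lyapunov_sub_le (div_pos hη (div_pos hk hq)), eventually_ge_atTop T₀]
    with T h1 h2 hTT a b τ ha hab hτ
  have ha0 : T₀ ≤ a := hTT.trans ha
  have hpL : ∀ t ∈ Icc a b, |p t j - p τ j| ≤ L * (b - a) := by
    intro t ht
    rcases le_total t τ with h | h
    · rw [abs_sub_comm]
      exact ((hLip t τ (ha0.trans ht.1) h).2 j).trans
        (mul_le_mul_of_nonneg_left (by linarith [ht.1, hτ.2]) hL)
    · exact ((hLip τ t (ha0.trans hτ.1) h).2 j).trans
        (mul_le_mul_of_nonneg_left (by linarith [ht.2, hτ.1]) hL)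
  have hbound : ∀ t ∈ Icc a b, |k * (margUtil u c (q t) i j - p t j) - k * (ps j - p τ j)| ≤
      η + k * L * (b - a) := by
    intro t ht
    rw [← mul_sub, abs_mul, abs_of_pos hk]
    have e1 := h1 t (ha.trans ht.1)
    have e2 := hpL t ht
    have e3 : |margUtil u c (q t) i j - p t j - (ps j - p τ j)| ≤ η / k + L * (b - a) := by
      rw [show margUtil u c (q t) i j - p t j - (ps j - p τ j) =
        (margUtil u c (q t) i j - ps j) - (p t j - p τ j) by ring]
      exact (abs_sub _ _).trans (add_le_add e1 e2)
    refine (mul_le_mul_of_nonneg_left e3 hk.le).trans_eq ?_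
    field_simp
  have hV := h2 a b ha (ha.trans hab)
  have hV' : k / qs i j * (lyapunov qs ps k kp (q a) (p a) - lyapunov qs ps k kp (q b) (p b))
      ≤ η := by
    refine (mul_le_mul_of_nonneg_left hV (div_pos hk hq).le).trans_eq ?_
    field_simp
  have hAC : LocAC fun t => q t i j := S.traj.demand_ac i j
  -- Adding $(k/q^*_{ij})V$ absorbs the projection excess. The opposite bound needs no correction,
  -- as projection never decreases the velocity.
  have up := (hAC.add (S.locAC_lyapunov.const_mul (k / qs i j))).sub_le_of_ae_deriv_le
    (M := k * (ps j - p τ j) + (η + k * L * (b - a))) (hT₀.trans ha0) hab (by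
      filter_upwards [S.traj.demand_eq, S.ae_lyapunov, S.ae_proj_demand_le hq] with t e1 e2 e3 ht
      refine ⟨_, (e1 i j).add (e2.const_mul _), ?_⟩
      have := (abs_le.1 (hbound t ht)).2
      linarith)
  have lo := hAC.neg.sub_le_of_ae_deriv_le
    (M := -(k * (ps j - p τ j)) + (η + k * L * (b - a))) (hT₀.trans ha0) hab (by
      filter_upwards [S.traj.demand_eq] with t e1 ht
      refine ⟨_, (e1 i j).neg, ?_⟩
      have := (abs_le.1 (hbound t ht)).1
      have := mul_le_mul_of_nonneg_left
        (le_projPlus (margUtil u c (q t) i j - p t j) (q t i j)) hk.le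
      linarith)
  rw [abs_le]
  constructor <;> nlinarith

/-- Asymptotically, prices move without projection. -/
theorem price_remainder (S : IsSetup u Q c qs ps k kp q p) (j : Fin J) :
    ∃ C, ∀ η > 0, ∀ᶠ T in atTop, ∀ a b τ, T ≤ a → a ≤ b → τ ∈ Icc a b →
      |p b j - p a j - (b - a) * (kp j * (∑ i, q τ i j - Q j))| ≤
        C * (b - a) ^ 2 + (η * (b - a) + η) := by
  obtain ⟨T₀, L, hT₀, hL, hLip⟩ := S.exists_lipschitz
  have hk := S.priceRate_pos j
  have hps := S.kkt.price_pos j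
  refine ⟨kp j * ∑ _i : Fin I, L, fun η hη => ?_⟩
  filter_upwards [S.eventually_lyapunov_sub_le (div_pos hη (div_pos hk hps)),
    eventually_ge_atTop T₀] with T h2 hTT a b τ ha hab hτ
  have ha0 : T₀ ≤ a := hTT.trans ha
  have hqL : ∀ t ∈ Icc a b, ∀ i, |q t i j - q τ i j| ≤ L * (b - a) := by
    intro t ht i
    rcases le_total t τ with h | h
    · rw [abs_sub_comm]
      exact ((hLip t τ (ha0.trans ht.1) h).1 i j).trans
        (mul_le_mul_of_nonneg_left (by linarith [ht.1, hτ.2]) hL)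
    · exact ((hLip τ t (ha0.trans hτ.1) h).1 i j).trans
        (mul_le_mul_of_nonneg_left (by linarith [ht.2, hτ.1]) hL)
  have hbound : ∀ t ∈ Icc a b, |kp j * (∑ i, q t i j - Q j) - kp j * (∑ i, q τ i j - Q j)| ≤
      (kp j * ∑ _i : Fin I, L) * (b - a) := by
    intro t ht
    rw [← mul_sub, abs_mul, abs_of_pos hk, mul_assoc, Finset.sum_mul]
    refine mul_le_mul_of_nonneg_left ?_ hk.le
    rw [show ∑ i, q t i j - Q j - (∑ i, q τ i j - Q j) = ∑ i, (q t i j - q τ i j) by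
      rw [Finset.sum_sub_distrib]; ring]
    exact (Finset.abs_sum_le_sum_abs _ _).trans (Finset.sum_le_sum fun i _ => hqL t ht i)
  have hV := h2 a b ha (ha.trans hab)
  have hV' : kp j / ps j * (lyapunov qs ps k kp (q a) (p a) - lyapunov qs ps k kp (q b) (p b))
      ≤ η := by
    refine (mul_le_mul_of_nonneg_left hV (div_pos hk hps).le).trans_eq ?_
    field_simp
  have hAC : LocAC fun t => p t j := S.traj.price_ac j
  set K := kp j * ∑ _i : Fin I, L with hK
  have up := (hAC.add (S.locAC_lyapunov.const_mul (kp j / ps j))).sub_le_of_ae_deriv_le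
    (M := kp j * (∑ i, q τ i j - Q j) + K * (b - a)) (hT₀.trans ha0) hab (by
      filter_upwards [S.traj.price_eq, S.ae_lyapunov, S.ae_proj_price_le j] with t e1 e2 e3 ht
      refine ⟨_, (e1 j).add (e2.const_mul _), ?_⟩
      have := (abs_le.1 (hbound t ht)).2
      linarith)
  have lo := hAC.neg.sub_le_of_ae_deriv_le
    (M := -(kp j * (∑ i, q τ i j - Q j)) + K * (b - a)) (hT₀.trans ha0) hab (by
      filter_upwards [S.traj.price_eq] with t e1 ht
      refine ⟨_, (e1 j).neg, ?_⟩
      have := (abs_le.1 (hbound t ht)).1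
      have := mul_le_mul_of_nonneg_left
        (le_projPlus (∑ i, q t i j - Q j) (p t j)) hk.le
      linarith)
  have := mul_nonneg hη.le (sub_nonneg.2 hab)
  rw [abs_le]
  constructor <;> nlinarith

/-- Asymptotically, the demand along an edge grows at least as fast as along an edge to the same
provider that carries positive demand at the KKT point. -/
theorem demand_sub_remainder (S : IsSetup u Q c qs ps k kp q p) {i i' : Fin I} {j : Fin J}
    (hG : c i j * marginal (u i) (effRes c qs i) = ps j) (hq : 0 < qs i' j) :
    ∀ η > 0, ∀ᶠ T in atTop, ∀ a b, T ≤ a → a ≤ b →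
      q a i j - q a i' j ≤ q b i j - q b i' j + (η * (b - a) + η) := by
  intro η hη
  have hk := S.rate_pos
  have hη' : 0 < η / (2 * k) := by positivity
  filter_upwards [S.eventually_margUtil_sub_le hG hη',
    S.eventually_margUtil_sub_le (S.kkt.marg_eq i' j hq) hη',
    S.eventually_lyapunov_sub_le (div_pos hη (div_pos hk hq)), eventually_ge_atTop 0]
    with T h1 h1' h2 hTT a b ha hab
  have hV' : k / qs i' j * (lyapunov qs ps k kp (q a) (p a) - lyapunov qs ps k kp (q b) (p b))
      ≤ η := by
    refine (mul_le_mul_of_nonneg_left (h2 a b ha (ha.trans hab)) (div_pos hk hq).le).trans_eq ?_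
    field_simp
  have hAC : LocAC fun t => q t i j := S.traj.demand_ac i j
  have hAC' : LocAC fun t => q t i' j := S.traj.demand_ac i' j
  -- The price cancels between two edges to the same provider. On `i'` the Lyapunov term absorbs the
  -- excess; on `i` the equilibrium demand may be zero and projection may persist, but it acts
  -- upwards, so one inequality survives.
  have := ((hAC'.sub hAC).add (S.locAC_lyapunov.const_mul (k / qs i' j))).sub_le_of_ae_deriv_le
    (M := η) (hTT.trans ha) hab (by
      filter_upwards [S.traj.demand_eq, S.ae_lyapunov, S.ae_proj_demand_le hq] with t e1 e2 e3 ht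
      refine ⟨_, ((e1 i' j).sub (e1 i j)).add (e2.const_mul _), ?_⟩
      have f1 := (abs_le.1 (h1 t (ha.trans ht.1))).1
      have f2 := (abs_le.1 (h1' t (ha.trans ht.1))).2
      have f3 := mul_le_mul_of_nonneg_left
        (le_projPlus (margUtil u c (q t) i j - p t j) (q t i j)) hk.le
      have f4 : k * (margUtil u c (q t) i' j - margUtil u c (q t) i j) ≤ η := by
        refine (mul_le_mul_of_nonneg_left (b := margUtil u c (q t) i' j - margUtil u c (q t) i j)
          (c := η / (2 * k) + η / (2 * k)) (by linarith) hk.le).trans_eq ?_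
        field_simp
        ring
      linarith)
  linarith

end IsSetup

/-! ### Limit flows. -/

/-- Limits of time translates of a trajectory. -/
structure IsLimitFlow (u : Fin I → ℝ → ℝ) (Q : Fin J → ℝ) (c qs : Fin I → Fin J → ℝ)
    (ps : Fin J → ℝ) (k : ℝ) (kp : Fin J → ℝ) (l C : ℝ) (q : ℝ → Fin I → Fin J → ℝ)
    (p : ℝ → Fin J → ℝ) : Prop where
  lyapunov_eq : ∀ s, lyapunov qs ps k kp (q s) (p s) = l
  effRes_eq : ∀ s i, effRes c (q s) i = effRes c qs i
  supp : ∀ s i j, c i j * marginal (u i) (effRes c qs i) ≠ ps j → q s i j = 0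
  demand : ∀ i j, 0 < qs i j → ∀ s s',
    |q s' i j - q s i j - (s' - s) * (k * (ps j - p s j))| ≤ C * (s' - s) ^ 2
  price : ∀ j s s',
    |p s' j - p s j - (s' - s) * (kp j * (∑ i, q s i j - Q j))| ≤ C * (s' - s) ^ 2
  mono : ∀ i i' j, c i j * marginal (u i) (effRes c qs i) = ps j → 0 < qs i' j →
    ∀ s s', s ≤ s' → q s i j - q s i' j ≤ q s' i j - q s' i' j

theorem tendsto_lyapunov {α : Type*} {f : Filter α} (qs : Fin I → Fin J → ℝ) (ps : Fin J → ℝ)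
    (k : ℝ) (kp : Fin J → ℝ) {q : α → Fin I → Fin J → ℝ} {p : α → Fin J → ℝ}
    {q' : Fin I → Fin J → ℝ} {p' : Fin J → ℝ} (hq : ∀ i j, Tendsto (fun t => q t i j) f (𝓝 (q' i j)))
    (hp : ∀ j, Tendsto (fun t => p t j) f (𝓝 (p' j))) :
    Tendsto (fun t => lyapunov qs ps k kp (q t) (p t)) f (𝓝 (lyapunov qs ps k kp q' p')) :=
  (tendsto_finsetSum _ fun i _ => tendsto_finsetSum _ fun j _ =>
    (((hq i j).sub_const _).mul ((hq i j).sub_const _)).const_mul _).add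
    (tendsto_finsetSum _ fun j _ => (((hp j).sub_const _).mul ((hp j).sub_const _)).const_mul _)

theorem tendsto_effRes_of_tendsto {α : Type*} {f : Filter α} (c : Fin I → Fin J → ℝ) (i : Fin I)
    {q : α → Fin I → Fin J → ℝ} {q' : Fin I → Fin J → ℝ}
    (hq : ∀ j, Tendsto (fun t => q t i j) f (𝓝 (q' i j))) :
    Tendsto (fun t => effRes c (q t) i) f (𝓝 (effRes c q' i)) :=
  tendsto_finsetSum _ fun j _ => (hq j).mul_const _

/-- The bounded Lyapunov function confines the trajectory to a compact ball, so one ultrafilter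
finer than `atTop` yields limits of all translates simultaneously, with no diagonal extraction. -/
theorem exists_ultrafilter_limit {qs : Fin I → Fin J → ℝ} {ps : Fin J → ℝ} {k : ℝ}
    {kp : Fin J → ℝ} (hk : 0 < k) (hkp : ∀ j, 0 < kp j) {q : ℝ → Fin I → Fin J → ℝ}
    {p : ℝ → Fin J → ℝ} {T M : ℝ} (h : ∀ t, T ≤ t → lyapunov qs ps k kp (q t) (p t) ≤ M)
    (𝒰 : Ultrafilter ℝ) (h𝒰 : (𝒰 : Filter ℝ) ≤ atTop) :
    ∃ (q' : ℝ → Fin I → Fin J → ℝ) (p' : ℝ → Fin J → ℝ),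
      (∀ s i j, Tendsto (fun t => q (t + s) i j) 𝒰 (𝓝 (q' s i j))) ∧
        ∀ s j, Tendsto (fun t => p (t + s) j) 𝒰 (𝓝 (p' s j)) := by
  have habs : ∀ {x y N : ℝ}, (x - y) ^ 2 ≤ N → |x| ≤ 1 + N + |y| := by
    intro x y N h
    have h1 : |x - y| ≤ 1 + N := abs_le.2 ⟨by nlinarith [sq_nonneg (x - y + 1)],
      by nlinarith [sq_nonneg (x - y - 1)]⟩
    have h2 := abs_add_le (x - y) y
    rw [sub_add_cancel] at h2
    linarith
  obtain ⟨B₁, hB₁⟩ := Finite.exists_le fun e : Fin I × Fin J => 1 + 2 * k * M + |qs e.1 e.2|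
  obtain ⟨B₂, hB₂⟩ := Finite.exists_le fun j : Fin J => 1 + 2 * kp j * M + |ps j|
  set R := max 0 (max B₁ B₂)
  have hball : ∀ t, T ≤ t → (q t, p t) ∈ Metric.closedBall (0 : (Fin I → Fin J → ℝ) × _) R := by
    intro t ht
    have hR : 0 ≤ R := le_max_left _ _
    rw [mem_closedBall_zero_iff]
    refine max_le ((pi_norm_le_iff_of_nonneg hR).2 fun i => (pi_norm_le_iff_of_nonneg hR).2
      fun j => ?_) ((pi_norm_le_iff_of_nonneg hR).2 fun j => ?_)
    · refine (habs ((sq_demand_le_lyapunov hk hkp (q t) (p t) i j).trans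
        (mul_le_mul_of_nonneg_left (h t ht) (by positivity)))).trans ?_
      exact (hB₁ (i, j)).trans ((le_max_left _ _).trans (le_max_right _ _))
    · have := hkp j
      refine (habs ((sq_price_le_lyapunov hk hkp (q t) (p t) j).trans
        (mul_le_mul_of_nonneg_left (h t ht) (by positivity)))).trans ?_
      exact (hB₂ j).trans ((le_max_right _ _).trans (le_max_right _ _))
  have hlim : ∀ s, ∃ z : (Fin I → Fin J → ℝ) × (Fin J → ℝ),
      Tendsto (fun t => (q (t + s), p (t + s))) 𝒰 (𝓝 z) := by
    intro s
    have hev : ∀ᶠ t in (𝒰 : Filter ℝ), (q (t + s), p (t + s)) ∈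
        Metric.closedBall (0 : (Fin I → Fin J → ℝ) × (Fin J → ℝ)) R := by
      filter_upwards [h𝒰 (eventually_ge_atTop (T - s))] with t ht
      exact hball _ (by linarith)
    obtain ⟨z, -, hz⟩ := (isCompact_closedBall (0 : (Fin I → Fin J → ℝ) × (Fin J → ℝ)) R
      ).ultrafilter_le_nhds' (𝒰.map fun t => (q (t + s), p (t + s))) hev
    exact ⟨z, hz⟩
  choose z hz using hlim
  exact ⟨fun s => (z s).1, fun s => (z s).2,
    fun s i j => tendsto_pi_nhds.1 (tendsto_pi_nhds.1 ((continuous_fst.tendsto _).comp (hz s)) i) j,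
    fun s j => tendsto_pi_nhds.1 ((continuous_snd.tendsto _).comp (hz s)) j⟩

theorem le_of_forall_pos_le_add_mul {x y r : ℝ} (hr : 0 ≤ r)
    (h : ∀ η > 0, x ≤ y + (η * r + η)) : x ≤ y := by
  refine le_of_forall_pos_le_add fun ε hε => ?_
  have := h (ε / (r + 1)) (by positivity)
  rwa [show ε / (r + 1) * r + ε / (r + 1) = ε by field_simp] at this

theorem exists_limitFlow {u : Fin I → ℝ → ℝ} {Q : Fin J → ℝ} {c qs : Fin I → Fin J → ℝ}
    {ps : Fin J → ℝ} {k : ℝ} {kp : Fin J → ℝ} {q : ℝ → Fin I → Fin J → ℝ} {p : ℝ → Fin J → ℝ}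
    (S : IsSetup u Q c qs ps k kp q p) {l : ℝ}
    (hl : Tendsto (fun t => lyapunov qs ps k kp (q t) (p t)) atTop (𝓝 l)) :
    ∃ C q' p', IsLimitFlow u Q c qs ps k kp l C q' p' := by
  set 𝒰 : Ultrafilter ℝ := Ultrafilter.of atTop
  have h𝒰 : (𝒰 : Filter ℝ) ≤ atTop := Ultrafilter.of_le _
  obtain ⟨q', p', hq, hp⟩ := exists_ultrafilter_limit S.rate_pos S.priceRate_pos
    (fun t (ht : 0 ≤ t) => S.lyapunov_anti le_rfl ht) 𝒰 h𝒰
  have hshift : ∀ s, Tendsto (fun t : ℝ => t + s) 𝒰 atTop := fun s =>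
    (tendsto_atTop_add_const_right _ s tendsto_id).mono_left h𝒰
  have hsum : ∀ s j, Tendsto (fun t => ∑ i, q (t + s) i j) 𝒰 (𝓝 (∑ i, q' s i j)) := fun s j =>
    tendsto_finsetSum _ fun i _ => hq s i j
  have pass : ∀ {f g : ℝ → ℝ} {f' g' : ℝ → ℝ} {C : ℝ},
      (∀ s, Tendsto (fun t => f (t + s)) 𝒰 (𝓝 (f' s))) →
      (∀ s, Tendsto (fun t => g (t + s)) 𝒰 (𝓝 (g' s))) →
      (∀ η > 0, ∀ᶠ T in atTop, ∀ a b τ, T ≤ a → a ≤ b → τ ∈ Icc a b →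
        |f b - f a - (b - a) * g τ| ≤ C * (b - a) ^ 2 + (η * (b - a) + η)) →
      ∀ s s', |f' s' - f' s - (s' - s) * g' s| ≤ C * (s' - s) ^ 2 := by
    intro f g f' g' C hf hg h
    -- The reference time `τ` may be either endpoint, which covers both signs of $s'-s$.
    have main : ∀ a b τ, a ≤ b → τ ∈ Icc a b →
        |f' b - f' a - (b - a) * g' τ| ≤ C * (b - a) ^ 2 := by
      intro a b τ hab hτ
      refine le_of_forall_pos_le_add_mul (sub_nonneg.2 hab) fun η hη => ?_
      refine le_of_tendsto ((((hf b).sub (hf a)).sub ((hg τ).const_mul (b - a))).abs) ?_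
      obtain ⟨T, hT⟩ := (h η hη).exists
      filter_upwards [(hshift a).eventually_ge_atTop T] with t ht
      have := hT (t + a) (t + b) (t + τ) ht (by linarith) ⟨by linarith [hτ.1], by linarith [hτ.2]⟩
      rwa [add_sub_add_left_eq_sub] at this
    intro s s'
    rcases le_total s s' with h1 | h1
    · exact main s s' s h1 ⟨le_rfl, h1⟩
    · have := main s' s s h1 ⟨h1, le_rfl⟩
      rw [← abs_neg, show -(f' s - f' s' - (s - s') * g' s) = f' s' - f' s - (s' - s) * g' s by
        ring, show (s - s') ^ 2 = (s' - s) ^ 2 by ring] at this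
      exact this
  have hCd : ∀ e : Fin I × Fin J, ∃ C, 0 < qs e.1 e.2 → ∀ s s',
      |q' s' e.1 e.2 - q' s e.1 e.2 - (s' - s) * (k * (ps e.2 - p' s e.2))| ≤
        C * (s' - s) ^ 2 := by
    intro e
    by_cases h : 0 < qs e.1 e.2
    · obtain ⟨C, hC⟩ := S.demand_remainder h
      exact ⟨C, fun _ => pass (f := fun t => q t e.1 e.2) (f' := fun s => q' s e.1 e.2)
        (g := fun t => k * (ps e.2 - p t e.2)) (g' := fun s => k * (ps e.2 - p' s e.2))
        (fun s => hq s _ _) (fun s => ((hp s _).const_sub _).const_mul _) hC⟩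
    · exact ⟨0, fun h' => absurd h' h⟩
  have hCp : ∀ j, ∃ C, ∀ s s',
      |p' s' j - p' s j - (s' - s) * (kp j * (∑ i, q' s i j - Q j))| ≤ C * (s' - s) ^ 2 := by
    intro j
    obtain ⟨C, hC⟩ := S.price_remainder j
    exact ⟨C, pass (f := fun t => p t j) (f' := fun s => p' s j)
      (g := fun t => kp j * (∑ i, q t i j - Q j)) (g' := fun s => kp j * (∑ i, q' s i j - Q j))
      (fun s => hp s _) (fun s => ((hsum s _).sub_const _).const_mul _) hC⟩
  choose Cd hCd using hCd
  choose Cp hCp using hCp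
  obtain ⟨C₁, hC₁⟩ := Finite.exists_le Cd
  obtain ⟨C₂, hC₂⟩ := Finite.exists_le Cp
  refine ⟨max C₁ C₂, q', p', fun s => ?_, fun s i => ?_, fun s i j hne => ?_,
    fun i j h s s' => ?_, fun j s s' => ?_, fun i i' j hG h s s' hss => ?_⟩
  · exact tendsto_nhds_unique (tendsto_lyapunov qs ps k kp (hq s) (hp s))
      (hl.comp (hshift s))
  · exact tendsto_nhds_unique (tendsto_effRes_of_tendsto c i (hq s i))
      ((S.tendsto_effRes i).comp (hshift s))
  · exact tendsto_nhds_unique (hq s i j) ((S.tendsto_demand_zero hne).comp (hshift s))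
  · exact (hCd (i, j) h s s').trans (mul_le_mul_of_nonneg_right
      ((hC₁ _).trans (le_max_left _ _)) (sq_nonneg _))
  · exact (hCp j s s').trans (mul_le_mul_of_nonneg_right
      ((hC₂ _).trans (le_max_right _ _)) (sq_nonneg _))
  · refine le_of_forall_pos_le_add_mul (sub_nonneg.2 hss) fun η hη => ?_
    refine le_of_tendsto_of_tendsto ((hq s i j).sub (hq s i' j))
      (((hq s' i j).sub (hq s' i' j)).add_const _) ?_
    obtain ⟨T, hT⟩ := (S.demand_sub_remainder hG h η hη).exists
    filter_upwards [(hshift s).eventually_ge_atTop T] with t ht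
    have := hT (t + s) (t + s') ht (by linarith)
    rwa [add_sub_add_left_eq_sub] at this

/-- Passing to a limit of translates again, the demands along edges to the same provider move in
parallel. -/
theorem IsLimitFlow.exists_parallel {u : Fin I → ℝ → ℝ} {Q : Fin J → ℝ}
    {c qs : Fin I → Fin J → ℝ} {ps : Fin J → ℝ} {k : ℝ} {kp : Fin J → ℝ} {l C : ℝ}
    {q : ℝ → Fin I → Fin J → ℝ} {p : ℝ → Fin J → ℝ} (hk : 0 < k) (hkp : ∀ j, 0 < kp j)
    (F : IsLimitFlow u Q c qs ps k kp l C q p) :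
    ∃ q' p', IsLimitFlow u Q c qs ps k kp l C q' p' ∧
      ∀ i i' j, c i j * marginal (u i) (effRes c qs i) = ps j → 0 < qs i' j →
        ∀ s s', q' s i j - q' s i' j = q' s' i j - q' s' i' j := by
  set 𝒰 : Ultrafilter ℝ := Ultrafilter.of atTop
  have h𝒰 : (𝒰 : Filter ℝ) ≤ atTop := Ultrafilter.of_le _
  obtain ⟨q', p', hq, hp⟩ := exists_ultrafilter_limit hk hkp
    (fun t (_ : 0 ≤ t) => (F.lyapunov_eq t).le) 𝒰 h𝒰
  have hsum : ∀ s j, Tendsto (fun t => ∑ i, q (t + s) i j) 𝒰 (𝓝 (∑ i, q' s i j)) := fun s j =>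
    tendsto_finsetSum _ fun i _ => hq s i j
  refine ⟨q', p', ⟨fun s => ?_, fun s i => ?_, fun s i j hne => ?_,
    fun i j h s s' => ?_, fun j s s' => ?_, fun i i' j hG h s s' hss => ?_⟩,
    fun i i' j hG h s s' => ?_⟩
  · refine tendsto_nhds_unique (tendsto_lyapunov qs ps k kp (hq s) (hp s)) ?_
    simp only [F.lyapunov_eq]
    exact tendsto_const_nhds
  · refine tendsto_nhds_unique (tendsto_effRes_of_tendsto c i (hq s i)) ?_
    simp only [F.effRes_eq]
    exact tendsto_const_nhds
  · refine tendsto_nhds_unique (hq s i j) ?_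
    simp only [F.supp _ i j hne]
    exact tendsto_const_nhds
  · refine le_of_tendsto ((((hq s' i j).sub (hq s i j)).sub
      ((((hp s j).const_sub (ps j)).const_mul k).const_mul (s' - s))).abs)
      (Eventually.of_forall fun t => ?_)
    have := F.demand i j h (t + s) (t + s')
    rwa [add_sub_add_left_eq_sub] at this
  · refine le_of_tendsto ((((hp s' j).sub (hp s j)).sub
      ((((hsum s j).sub_const (Q j)).const_mul (kp j)).const_mul (s' - s))).abs)
      (Eventually.of_forall fun t => ?_)
    have := F.price j (t + s) (t + s')
    rwa [add_sub_add_left_eq_sub] at this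
  · exact le_of_tendsto_of_tendsto ((hq s i j).sub (hq s i' j))
      ((hq s' i j).sub (hq s' i' j)) (Eventually.of_forall fun t =>
        F.mono i i' j hG h _ _ (by linarith))
  -- A monotone function whose translates converge along the ultrafilter has a limit independent of
  -- the shift, namely its supremum.
  · have hmono : Monotone fun t => q t i j - q t i' j := fun a b hab => F.mono i i' j hG h a b hab
    have hlim2 : ∀ s, Tendsto (fun t => q (t + s) i j - q (t + s) i' j) 𝒰
        (𝓝 (q' s i j - q' s i' j)) := fun s => (hq s i j).sub (hq s i' j)
    have hle : ∀ s s', q' s i j - q' s i' j ≤ q' s' i j - q' s' i' j := by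
      intro s s'
      have hub : ∀ r, q r i j - q r i' j ≤ q' s' i j - q' s' i' j := fun r => by
        refine ge_of_tendsto (hlim2 s') ?_
        filter_upwards [h𝒰 (eventually_ge_atTop (r - s'))] with t ht
        exact hmono (by linarith)
      exact le_of_tendsto (hlim2 s) (Eventually.of_forall fun t => hub _)
    exact le_antisymm (hle s s') (hle s' s)

/-! ### Harmonic oscillators on a forest. -/

theorem hasDerivAt_of_abs_sub_le_sq {f : ℝ → ℝ} {s d C : ℝ}
    (h : ∀ s', |f s' - f s - (s' - s) * d| ≤ C * (s' - s) ^ 2) : HasDerivAt f d s := by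
  rw [hasDerivAt_iff_isLittleO]
  refine Asymptotics.IsBigO.trans_isLittleO (g := fun x : ℝ => ‖x - s‖ ^ 2)
    (Asymptotics.IsBigO.of_bound C (Eventually.of_forall fun x => ?_))
    (Asymptotics.isLittleO_pow_sub_sub s one_lt_two)
  simpa only [smul_eq_mul, Real.norm_eq_abs, sq_abs, abs_pow] using h x

/-- Harmonic oscillations with distinct frequencies are linearly independent. -/
theorem mul_eq_zero_of_sum_oscillators {ι : Type*} {w v : ι → ℝ → ℝ} {ν : ι → ℝ}
    (hw : ∀ j s, HasDerivAt (w j) (v j s) s) (hv : ∀ j s, HasDerivAt (v j) (-(ν j) * w j s) s)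
    (S : Finset ι) (hν : Set.InjOn ν S) (a : ι → ℝ) (h : ∀ s, ∑ j ∈ S, a j * w j s = 0) :
    ∀ j ∈ S, ∀ s, a j * w j s = 0 := by
  classical
  induction S using Finset.induction_on generalizing a with
  | empty => simp
  | insert j₀ S hj₀ ih =>
    have h1 : ∀ s, ∑ j ∈ insert j₀ S, a j * v j s = 0 := fun s =>
      (HasDerivAt.fun_sum fun j (_ : j ∈ insert j₀ S) => (hw j s).const_mul (a j)).unique
        ((hasDerivAt_const s (0 : ℝ)).congr_of_eventuallyEq (Eventually.of_forall h))
    have h2 : ∀ s, ∑ j ∈ insert j₀ S, a j * (-(ν j) * w j s) = 0 := fun s =>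
      (HasDerivAt.fun_sum fun j (_ : j ∈ insert j₀ S) => (hv j s).const_mul (a j)).unique
        ((hasDerivAt_const s (0 : ℝ)).congr_of_eventuallyEq (Eventually.of_forall h1))
    -- Adding $\nu_{j_0}$ times the relation to its second derivative eliminates the $j_0$ term;
    -- distinct frequencies keep the other factors nonzero.
    have h3 : ∀ s, ∑ j ∈ S, (a j * (ν j₀ - ν j)) * w j s = 0 := by
      intro s
      have e1 := h s
      have e2 := h2 s
      rw [Finset.sum_insert hj₀] at e1 e2
      have e3 : ∑ j ∈ S, (a j * (ν j₀ - ν j)) * w j s =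
          ν j₀ * ∑ j ∈ S, a j * w j s + ∑ j ∈ S, a j * (-(ν j) * w j s) := by
        rw [Finset.mul_sum, ← Finset.sum_add_distrib]
        exact Finset.sum_congr rfl fun j _ => by ring
      rw [e3]
      linear_combination ν j₀ * e1 + e2
    have h4 : ∀ j ∈ S, ∀ s, a j * w j s = 0 := by
      intro j hj s
      have h5 := ih (hν.mono (by simp)) _ h3 j hj s
      have h6 : ν j₀ - ν j ≠ 0 := sub_ne_zero.2 fun he =>
        hj₀ (by rwa [hν (by simp) (by simp [hj]) he])
      rw [mul_assoc, mul_left_comm] at h5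
      exact (mul_eq_zero.1 h5).resolve_left h6
    intro j hj s
    rcases Finset.mem_insert.1 hj with rfl | hj
    · have := h s
      rwa [Finset.sum_insert hj₀, Finset.sum_eq_zero fun i hi => h4 i hi s, add_zero] at this
    · exact h4 j hj s

/-- Number of users that are indifferent to provider `j` at the KKT point. -/
def edgeDegree (G : Fin I → Fin J → Prop) (j : Fin J) : ℕ := {i | G i j}.ncard

theorem one_le_edgeDegree {G : Fin I → Fin J → Prop} {i : Fin I} {j : Fin J} (h : G i j) :
    1 ≤ edgeDegree G j :=
  (Set.ncard_pos (Set.toFinite _)).2 ⟨i, h⟩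

/-- On a forest, price oscillations that cancel out at every user vanish, as soon as price update
rates are not integer multiples of each other. -/
theorem oscillators_eq_zero {G : Fin I → Fin J → Prop}
    (hforest : ∀ y : Fin I → Fin J → ℝ, (∀ i j, y i j ≠ 0 → G i j) → (∀ i, ∑ j, y i j = 0) →
      (∀ j, ∑ i, y i j = 0) → y = 0)
    (hne : ∀ j, ∃ i, G i j) {k : ℝ} (hk : 0 < k) {kp : Fin J → ℝ}
    (hkp : ∀ j j', j ≠ j' → ∀ a : ℕ, 0 < a → kp j ≠ a * kp j')
    {w v : Fin J → ℝ → ℝ} (hw : ∀ j s, HasDerivAt (w j) (v j s) s)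
    (hv : ∀ j s, HasDerivAt (v j) (-(k * kp j * edgeDegree G j) * w j s) s)
    {c : Fin I → Fin J → ℝ} (hc : ∀ i j, 0 < c i j)
    (hsum : ∀ i s, ∑ j, (open Classical in if G i j then c i j * w j s else 0) = 0) :
    ∀ j s, w j s = 0 := by
  classical
  have step : ∀ i j₀, G i j₀ →
      (∀ j, j ≠ j₀ → G i j → (¬ ∀ s, w j s = 0) → edgeDegree G j = 1) → ∀ s, w j₀ s = 0 := by
    intro i j₀ hij₀ hdeg
    by_contra hcon
    set S := Finset.univ.filter fun j => G i j ∧ ¬ ∀ s, w j s = 0 with hS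
    have hmem : ∀ {j}, j ∈ S ↔ G i j ∧ ¬ ∀ s, w j s = 0 := by simp [hS]
    -- Of two distinct moving providers at `i`, at least one differs from `j₀` and has degree $1$.
    -- Equal frequencies would then make its price rate the other's rate times the other's degree.
    have hinj : Set.InjOn (fun j => k * kp j * edgeDegree G j) S := by
      have main : ∀ j j', j ≠ j' → edgeDegree G j = 1 → G i j' →
          k * kp j * edgeDegree G j ≠ k * kp j' * edgeDegree G j' := by
        intro j j' hjj hd hG he
        refine hkp j j' hjj _ (one_le_edgeDegree hG) ?_
        rw [hd, mul_assoc, mul_assoc] at he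
        have := mul_left_cancel₀ hk.ne' he
        push_cast at this
        linarith
      intro j hj j' hj' he
      by_contra hjj
      have h1 := hmem.1 hj
      have h2 := hmem.1 hj'
      by_cases hj0 : j = j₀
      · exact main j' j (Ne.symm hjj) (hdeg j' (fun h => hjj (hj0.trans h.symm)) h2.1 h2.2) h1.1
          he.symm
      · exact main j j' hjj (hdeg j hj0 h1.1 h1.2) h2.1 he
    have hz := mul_eq_zero_of_sum_oscillators hw hv S hinj (fun j => c i j) (fun s => by
      rw [← hsum i s, hS, Finset.sum_filter]
      refine Finset.sum_congr rfl fun j _ => ?_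
      by_cases h1 : G i j
      · by_cases h2 : ∀ s, w j s = 0
        · simp [h2]
        · simp only [h1, h2, not_false_eq_true, and_self, if_true]
      · simp [h1])
    exact hcon fun s => (mul_eq_zero.1 (hz j₀ (hmem.2 ⟨hij₀, hcon⟩) s)).resolve_left
      (hc i j₀).ne'
  by_contra! hcon
  obtain ⟨j₁, s₁, hj₁⟩ := hcon
  set H : Finset (Fin I × Fin J) := Finset.univ.filter fun e =>
    G e.1 e.2 ∧ (¬ ∀ s, w e.2 s = 0) ∧ edgeDegree G e.2 ≠ 1 with hH
  have hmem : ∀ {i j}, (i, j) ∈ H ↔ G i j ∧ (¬ ∀ s, w j s = 0) ∧ edgeDegree G j ≠ 1 := by simp [hH]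
  rcases H.eq_empty_or_nonempty with hemp | hnonempty
  · obtain ⟨i, hi⟩ := hne j₁
    refine hj₁ (step i j₁ hi (fun j _ hG hj => ?_) s₁)
    by_contra hd
    have : (i, j) ∈ H := hmem.2 ⟨hG, hj, hd⟩
    simp [hemp] at this
  -- Every provider occurring in `H` has at least two edges there. If every user did too, the forest
  -- would carry a nonzero circulation; so some user has a single edge in `H`, and `step` stops the
  -- provider on it.
  · by_cases hrow : ∀ e ∈ H, ∃ b, b ≠ e.2 ∧ (e.1, b) ∈ H
    · obtain ⟨y, hy0, hy, hyr, hyc⟩ := exists_circulation H hnonempty hrow (by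
        rintro ⟨i, j⟩ he
        obtain ⟨h1, h2, h3⟩ := hmem.1 he
        have h4 : 1 < {i | G i j}.ncard := lt_of_le_of_ne (one_le_edgeDegree h1) (Ne.symm h3)
        obtain ⟨i', hi', hne'⟩ := Set.exists_ne_of_one_lt_ncard h4 i
        exact ⟨i', hne', hmem.2 ⟨hi', h2, h3⟩⟩)
      exact hy0 (hforest y (fun i j h => (hmem.1 (hy i j h)).1) hyr hyc)
    · push Not at hrow
      obtain ⟨⟨i, j₀⟩, he, hrow⟩ := hrow
      obtain ⟨h1, h2, h3⟩ := hmem.1 he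
      refine h2 (step i j₀ h1 fun j hj hG hw' => ?_)
      by_contra hd
      exact hrow j hj (hmem.2 ⟨hG, hw', hd⟩)

/-! ### Identification of the limit and convergence. -/

theorem IsKKT.exists_pos {u : Fin I → ℝ → ℝ} {Q : Fin J → ℝ} {c q : Fin I → Fin J → ℝ}
    {p : Fin J → ℝ} (h : IsKKT u Q c q p) (hQ : ∀ j, 0 < Q j) (j : Fin J) : ∃ i, 0 < q i j := by
  by_contra! hcon
  have := Finset.sum_nonpos (s := Finset.univ) fun i _ => hcon i
  rw [h.supply j] at this
  linarith [hQ j]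

/-- A limit flow whose demands move in parallel along the edges to each provider rests at the KKT
point. -/
theorem IsLimitFlow.eq_of_parallel {u : Fin I → ℝ → ℝ} (hu : ∀ i, IsUtility (u i)) {Q : Fin J → ℝ}
    (hQ : ∀ j, 0 < Q j) {c qs : Fin I → Fin J → ℝ} (hc : ∀ i j, 0 < c i j)
    (hforest : HasForestSupports c) {ps : Fin J → ℝ} (hkkt : IsKKT u Q c qs ps) {k : ℝ}
    (hk : 0 < k) {kp : Fin J → ℝ} (hkp : ∀ j, 0 < kp j)
    (hkp' : ∀ j j', j ≠ j' → ∀ a : ℕ, 0 < a → kp j ≠ a * kp j') {l C : ℝ}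
    {q : ℝ → Fin I → Fin J → ℝ} {p : ℝ → Fin J → ℝ} (F : IsLimitFlow u Q c qs ps k kp l C q p)
    (hpar : ∀ i i' j, c i j * marginal (u i) (effRes c qs i) = ps j → 0 < qs i' j →
        ∀ s s', q s i j - q s i' j = q s' i j - q s' i' j) (s : ℝ) : q s = qs ∧ p s = ps := by
  classical
  set G : Fin I → Fin J → Prop := fun i j => c i j * marginal (u i) (effRes c qs i) = ps j with hG
  have hdq : ∀ i j s, HasDerivAt (fun s => q s i j)
      (if G i j then k * (ps j - p s j) else 0) s := by
    intro i j s
    by_cases h : G i j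
    · rw [if_pos h]
      -- The differential estimate is known only on edges with positive equilibrium demand; parallel
      -- motion transfers it to every tight edge of the same provider.
      obtain ⟨i', hi'⟩ := hkkt.exists_pos hQ j
      refine hasDerivAt_of_abs_sub_le_sq (C := C) fun s' => ?_
      have h1 := hpar i i' j h hi' s s'
      have h2 := F.demand i' j hi' s s'
      rwa [show q s' i' j - q s i' j = q s' i j - q s i j by linarith] at h2
    · rw [if_neg h]
      exact (hasDerivAt_const s (0 : ℝ)).congr_of_eventuallyEq
        (Eventually.of_forall fun t => F.supp t i j h)
  have hdp : ∀ j s, HasDerivAt (fun s => p s j) (kp j * (∑ i, q s i j - Q j)) s := fun j s =>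
    hasDerivAt_of_abs_sub_le_sq (F.price j s)
  have hw : ∀ j s, HasDerivAt (fun s => p s j - ps j) (kp j * (∑ i, q s i j - Q j)) s :=
    fun j s => (hdp j s).sub_const _
  have hv : ∀ j s, HasDerivAt (fun s => kp j * (∑ i, q s i j - Q j))
      (-(k * kp j * edgeDegree G j) * (p s j - ps j)) s := by
    intro j s
    have h1 := ((HasDerivAt.fun_sum fun i (_ : i ∈ Finset.univ) => hdq i j s).sub_const
      (Q j)).const_mul (kp j)
    refine h1.congr_deriv ?_
    rw [← Finset.sum_filter, Finset.sum_const, nsmul_eq_mul, edgeDegree,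
      Set.ncard_eq_toFinset_card', Set.toFinset_ofPred]
    ring
  -- This is the vanishing derivative of the constant effective resource, divided by $-k$.
  have hsum : ∀ i s, ∑ j, (if G i j then c i j * (p s j - ps j) else 0) = 0 := by
    intro i s
    have h1 : HasDerivAt (fun s => effRes c (q s) i)
        (∑ j, (if G i j then k * (ps j - p s j) else 0) * c i j) s :=
      HasDerivAt.fun_sum fun j _ => (hdq i j s).mul_const _
    have h2 := h1.unique ((hasDerivAt_const s (effRes c qs i)).congr_of_eventuallyEq
      (Eventually.of_forall fun t => F.effRes_eq t i))
    have h3 : ∑ j, (if G i j then k * (ps j - p s j) else 0) * c i j =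
        -k * ∑ j, (if G i j then c i j * (p s j - ps j) else 0) := by
      rw [Finset.mul_sum]
      refine Finset.sum_congr rfl fun j _ => ?_
      split_ifs <;> ring
    rw [h3] at h2
    exact (mul_eq_zero.1 h2).resolve_left (neg_ne_zero.2 hk.ne')
  have hw0 := oscillators_eq_zero (G := G) (fun y hy hyr hyc => hforest _ ps
      (fun i => (hu i).marginal_pos (hkkt.effRes_pos i)) hkkt.price_pos y hy hyr hyc)
    (fun j => (hkkt.exists_pos hQ j).imp fun i hi => hkkt.marg_eq i j hi) hk hkp'
    (w := fun j s => p s j - ps j) hw hv hc hsum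
  have hp : ∀ s j, p s j = ps j := fun s j => sub_eq_zero.1 (hw0 j s)
  refine ⟨hkkt.demand_unique hu hforest (F.supp s) (fun j => ?_) (F.effRes_eq s), funext (hp s)⟩
  have h1 := (hw j s).unique ((hasDerivAt_const s (0 : ℝ)).congr_of_eventuallyEq
    (Eventually.of_forall fun t => hw0 j t))
  have := (mul_eq_zero.1 h1).resolve_left (hkp j).ne'
  linarith

theorem IsSetup.tendsto {u : Fin I → ℝ → ℝ} {Q : Fin J → ℝ} (hQ : ∀ j, 0 < Q j)
    {c qs : Fin I → Fin J → ℝ} {ps : Fin J → ℝ} {k : ℝ} {kp : Fin J → ℝ}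
    {q : ℝ → Fin I → Fin J → ℝ} {p : ℝ → Fin J → ℝ} (S : IsSetup u Q c qs ps k kp q p)
    (hforest : HasForestSupports c)
    (hkp : ∀ j j', j ≠ j' → ∀ a : ℕ, 0 < a → kp j ≠ a * kp j') :
    Tendsto (fun t => (q t, p t)) atTop (𝓝 (qs, ps)) := by
  obtain ⟨l, hl⟩ := S.exists_tendsto_lyapunov
  obtain ⟨C, q', p', F⟩ := exists_limitFlow S hl
  obtain ⟨q'', p'', F', hpar⟩ := F.exists_parallel S.rate_pos S.priceRate_pos
  have heq := F'.eq_of_parallel S.utility hQ S.offset_pos hforest S.kkt S.rate_pos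
    S.priceRate_pos hkp hpar 0
  -- The limit flow has constant Lyapunov value `l` yet sits at the equilibrium. Monotonicity along
  -- the original trajectory then upgrades convergence along an ultrafilter to full convergence.
  have hl0 : l = 0 := by
    rw [← F'.lyapunov_eq 0, heq.1, heq.2]
    simp [lyapunov]
  rw [hl0] at hl
  have habs : ∀ {f : ℝ → ℝ} {y r : ℝ},
      (∀ t, (f t - y) ^ 2 ≤ r * lyapunov qs ps k kp (q t) (p t)) → Tendsto f atTop (𝓝 y) := by
    intro f y r h
    have h1 : Tendsto (fun t => (f t - y) ^ 2) atTop (𝓝 0) :=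
      squeeze_zero (fun t => sq_nonneg _) h (by simpa using hl.const_mul r)
    have h2 := (Real.continuous_sqrt.tendsto 0).comp h1
    rw [tendsto_iff_dist_tendsto_zero]
    simpa only [Function.comp_def, Real.sqrt_sq_eq_abs, Real.sqrt_zero, Real.dist_eq] using h2
  exact (tendsto_pi_nhds.2 fun i => tendsto_pi_nhds.2 fun j =>
      habs fun t => sq_demand_le_lyapunov S.rate_pos S.priceRate_pos (q t) (p t) i j).prodMk_nhds
    (tendsto_pi_nhds.2 fun j =>
      habs fun t => sq_price_le_lyapunov S.rate_pos S.priceRate_pos (q t) (p t) j)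

end ProviderCompetition

end

theorem mainTheorem4 {Ω : Type*} [MeasurableSpace Ω] (μ : Measure Ω) [IsProbabilityMeasure μ]
    (I J : ℕ) (hIJ : I < J)
    (u : Fin I → ℝ → ℝ) (hu : ∀ i, ProviderCompetition.IsUtility (u i))
    (Q : Fin J → ℝ) (hQ : ∀ j, 0 < Q j)
    (c : Fin I → Fin J → Ω → ℝ)
    (hc_meas : ∀ i j, Measurable (c i j))
    (hc_indep : iIndepFun (fun e : Fin I × Fin J => c e.1 e.2) μ)
    (hc_cont : ∀ i j, ∀ x : ℝ, μ {ω | c i j ω = x} = 0)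
    (hc_pos : ∀ i j, ∀ᵐ ω ∂μ, 0 < c i j ω) :
    ∀ᵐ ω ∂μ, ∀ (qs : Fin I → Fin J → ℝ) (ps : Fin J → ℝ),
      ProviderCompetition.IsEquilibrium u Q (fun i j => c i j ω) qs ps →
      (∀ i, 1 < {j | 0 < qs i j}.ncard) →
      -- the equilibrium is unique
      (∀ (q' : Fin I → Fin J → ℝ) (p' : Fin J → ℝ),
        ProviderCompetition.IsEquilibrium u Q (fun i j => c i j ω) q' p' → q' = qs ∧ p' = ps) ∧
      -- every trajectory converges to it
      ∀ (kq : Fin I → Fin J → ℝ) (kp : Fin J → ℝ),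
        (∃ k : ℝ, 0 < k ∧ ∀ i j, kq i j = k) →
        (∀ j, 0 < kp j) →
        (∀ j j', j ≠ j' → ∀ a : ℕ, 0 < a → kp j ≠ a * kp j') →
        ∀ (q : ℝ → Fin I → Fin J → ℝ) (p : ℝ → Fin J → ℝ),
          ProviderCompetition.IsTrajectory u Q (fun i j => c i j ω) kq kp q p →
          Tendsto (fun t => (q t, p t)) atTop (𝓝 (qs, ps)) := by
  have hpos : ∀ᵐ ω ∂μ, ∀ i j, 0 < c i j ω :=
    ae_all_iff.2 fun i => ae_all_iff.2 fun j => hc_pos i j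
  filter_upwards [ProviderCompetition.ae_hasForestSupports hc_meas hc_indep hc_cont hc_pos, hpos]
    with ω hforest hc qs ps heq hund
  -- An undecided user has some positive demand, hence a positive effective resource, where the
  -- utility is differentiable.
  have hx : ∀ i, 0 < ProviderCompetition.effRes (fun i j => c i j ω) qs i := fun i => by
    obtain ⟨j, hj⟩ := Set.nonempty_of_ncard_ne_zero (zero_lt_one.trans (hund i)).ne'
    exact ProviderCompetition.effRes_pos_of_pos hc heq.mem_feasible.1 hj
  refine ⟨fun q' p' h' => heq.unique h' hu hQ hc hforest hx, ?_⟩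
  rintro kq kp ⟨k, hk, hkq⟩ hkp hkp' q p htraj
  obtain rfl : kq = fun _ _ => k := funext fun i => funext fun j => hkq i j
  exact ProviderCompetition.IsSetup.tendsto hQ
    ⟨hu, hc, heq.isKKT hu hQ hc hx, hk, hkp, htraj⟩ hforest hkp'
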